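/- **Leader sequence quality theorem for the Prism backbone protocol.** *Model.* Blocks come in $m+1$ categories: $0$-blocks (proposer blocks) and $j$-blocks, $1\le j\le m$ (voter blocks). For a fixed adversarial strategy everything below lives on one probability space. For each $j$ there is an honest genesis $j$-block $0$, mined at time $0$; later $j$-blocks are numbered $1,2,\dots$ in the order of their mining times $T^j_1\le T^j_2\le\cdots$, with $0<T^j_k\to\infty$. Every non-genesis $j$-block has a parent $j$-block mined strictly earlier, so it ends a unique $j$-blockchain starting at genesis; its height $h^j(k)$ is the number of non-genesis blocks in that blockchain. Block $k$ is published at time $P^j_k\in[T^j_k,\infty]$, not before its parent. With $\Delta>0$ a bound on communication delays, $j$-blockchain $b$ is *$t$-credible* if $P^j_b\le t$ and $h^j(b)\ge h^j(k)$ for all $k$ with $P^j_k\le t-\Delta$. An honest $j$-block $k$ satisfies $P^j_k=T^j_k$ and (if $k\geq 1$) extends a $T^j_k$-credible $j$-blockchain. Other blocks are adversarial. The counting processes of the honest non-genesis $j$-blocks, $0\le j\le m$, are independent homogeneous Poisson processes of rate $\alpha$. The number $Z^j_{s,t}$ of adversarial $j$-blocks mined in $(s,t]$ satisfies $P(Z^j_{s,t}\le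 a)\ge e^{-\beta(t-s)}\sum_{i=0}^{\lfloor a\rfloor}\frac{(\beta(t-s))^i}{i!}$ for all real $a$ and $0\le s<t$. A voter block may vote, at each height $h\ge1$ at which some proposer block was published before the voter block was mined, for one proposer block of height $h$. An honest voter block mined at time $T$ votes on every height not voted on by its ancestors at which a proposer block was published by time $T-\Delta$, and chooses the first observed proposer block of that height (each block being observed between its publication and $\Delta$ later). Along a voter blockchain only the first vote on each height counts. $(0,b_1,\dots,b_n)$ is a *$t$-credible leader sequence* if $n$ is at least the height of every $0$-blockchain published by time $t-\Delta$ and there are $t$-credible voter $j$-blockchains, one for each $j\in\{1,\dots,m\}$, such that for every $\ell\in\{1,\dots,n\}$ block $b_\ell$ has the most votes from them (ties broken arbitrarily) among all proposer blocks of height $\ell$ published by time $t$. *Parameters and events.* Let $\alpha>\frac12$, $\beta\ge0$, $0<\delta<\frac{40}{81}$, $g=e^{-\alpha\Delta}$, and assume $(1-\frac{81}{40}\delta)g^2\alpha>\beta$. Put $\eta=\delta^2g^2\alpha$ and $\mu=9e^{\frac{2}{27}\eta}/(1-e^{-\frac1{27}\eta})^2$. A *lagger* is a non-genesis honest $0$-block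 $k$ that is the only honest $0$-block (genesis included) mined in $[T^0_k-\Delta,T^0_k]$; it is a *loner* if it is also the only one mined in $[T^0_k,T^0_k+\Delta]$. Let $N_{s,t},X_{s,t},Y_{s,t},Z_{s,t}$ be the numbers of honest $0$-blocks, laggers, loners and adversarial $0$-blocks mined in $(s,t]$. For $0\le s<t$ let $E_{s,t}$ be the event that $$(1-\delta)(t-s)\alpha<N_{s,t}<(1+\delta)(t-s)\alpha,\quad (1-\delta)(t-s)g\alpha<X_{s,t},$$ $$(1-\delta)(t-s)g^2\alpha<Y_{s,t},\quad Z_{s,t}<(t-s)\beta+(t-s)g^2\alpha\delta,$$ and let $G_{s,t}=\bigcap_{a\in[0,s],\,b\in[t,\infty)}E_{a,b}$. *Theorem.* Suppose the integer $k$ and the real number $t$ satisfy $k\ge\frac{160\alpha(1+\Delta)}{\delta}$ and $t\ge\frac{k}{(1-\frac{41}{40}\delta)g\alpha}$. Under the event $G_{t-\frac{k}{2\alpha}+\Delta,\;t-\Delta}$, every $t$-credible leader sequence $(0,b_1,\dots,b_n)$ has $n\ge k$, and at least $(1-g)k$ of its last $k$ blocks $b_{n-k+1},\dots,b_n$ are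 honest. As a consequence, the (outer) probability that some $t$-credible leader sequence has $n<k$ or has more than $gk$ adversarial blocks among its last $k$ blocks does not exceed $\mu e^{-\frac{\eta}{27}\left(\frac{k}{2\alpha}-2\Delta\right)}$. -/

import Mathlib

open MeasureTheory ProbabilityTheory
open scoped NNReal ENNReal

noncomputable section

/-- A counting process `N` (indexed by time in `[0, ∞)`) is a homogeneous Poisson process of
rate `r`: it starts at `0`, is nondecreasing, has independent increments, and its increment over
`(s, t]` is Poisson distributed with parameter `r * (t - s)`. -/
structure IsPoissonProcess {Ω : Type*} [MeasurableSpace Ω] (N : ℝ≥0 → Ω → ℕ) (r : ℝ)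
    (P : Measure Ω) : Prop where
  zero : ∀ ω, N 0 ω = 0
  mono : ∀ ω, Monotone fun t => N t ω
  indep : HasIndepIncrements N P
  law : ∀ s t : ℝ≥0, s < t →
    HasLaw (fun ω => N t ω - N s ω) (poissonMeasure (Real.toNNReal (r * (t - s)))) P

/-- Height of block `k` with respect to the parent function `f`: the number of non-genesis blocks
on the path from `k` back to the genesis block `0`, that is, the number of parental references
to be followed from `k` until `0` is reached. -/
def blockHeight (f : ℕ → ℕ) (k : ℕ) : ℕ := sInf {i | f^[i] k = 0}

/-- Block `b` (identified with the blockchain that ends in it) is `t`-credible: it has been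
published by time `t`, and it is no shorter than any blockchain published by time `t - Δ`.
Here `f` gives parents and `pub` gives publication times. -/
def CredibleChain (f : ℕ → ℕ) (pub : ℕ → EReal) (Δ t : ℝ) (b : ℕ) : Prop :=
  pub b ≤ (t : EReal) ∧
    ∀ k, pub k ≤ ((t - Δ : ℝ) : EReal) → blockHeight f k ≤ blockHeight f b

/-- The number of blocks with property `H` (honest, say) that are mined during `(s, t]`, when `T`
gives the mining times. -/
def minedCount (T : ℕ → ℝ) (H : ℕ → Prop) (s t : ℝ) : ℕ :=
  Set.ncard {k | H k ∧ s < T k ∧ T k ≤ t}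

/-- The Prism backbone protocol with `m` voter blockchains, run under some adversarial strategy,
on the probability space `(Ω, P)`.
Blocks come in `m + 1` categories: category `0` are the proposer blocks, categories `j.succ` with
`j : Fin m` are the voter blocks. In each category the blocks are numbered `0, 1, 2, …`
in the order in which they are mined, `0` being the genesis block.
`α` is the honest mining rate per category, `β` bounds the adversarial mining rate per category,
and `Δ` bounds the communication delays. A block that is not honest is adversarial. -/
structure PrismModel {Ω : Type*} [MeasurableSpace Ω] (P : Measure Ω) (m : ℕ) (α β Δ : ℝ) where
  /-- mining time of a block -/
  T : Fin (m + 1) → Ω → ℕ → ℝ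
  /-- whether a block is honest -/
  honest : Fin (m + 1) → Ω → ℕ → Prop
  /-- parent of a block (the value at the genesis block has no meaning) -/
  parent : Fin (m + 1) → Ω → ℕ → ℕ
  /-- publication time of a block, `⊤` if it is never published -/
  pub : Fin (m + 1) → Ω → ℕ → EReal
  /-- `vote j ω b h` is the proposer block of height `h` chosen by block `b` of voter category
  `j.succ`, or `none` if this block does not vote on height `h` -/
  vote : Fin m → Ω → ℕ → ℕ → Option ℕ
  -- random variables
  measurable_T : ∀ j k, Measurable fun ω => T j ω k
  measurable_honest : ∀ j k, MeasurableSet {ω | honest j ω k}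
  -- mining: genesis at time zero, then finitely many blocks in every bounded time interval
  T_genesis : ∀ j ω, T j ω 0 = 0
  T_pos : ∀ j ω k, 1 ≤ k → 0 < T j ω k
  T_mono : ∀ j ω, Monotone (T j ω)
  T_tendsto : ∀ j ω, Filter.Tendsto (T j ω) Filter.atTop Filter.atTop
  honest_genesis : ∀ j ω, honest j ω 0
  -- the parent has a smaller number and is mined strictly earlier
  parent_lt : ∀ j ω k, 1 ≤ k → parent j ω k < k
  T_parent_lt : ∀ j ω k, 1 ≤ k → T j ω (parent j ω k) < T j ω k
  -- a block is published after it is mined, and together with its blockchain at the latest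
  T_le_pub : ∀ j ω k, (T j ω k : EReal) ≤ pub j ω k
  pub_parent_le : ∀ j ω k, 1 ≤ k → pub j ω (parent j ω k) ≤ pub j ω k
  -- an honest block is published as soon as it is mined, and it extends a blockchain which is
  -- credible at that time
  honest_pub : ∀ j ω k, honest j ω k → pub j ω k = (T j ω k : EReal)
  honest_parent : ∀ j ω k, 1 ≤ k → honest j ω k →
    CredibleChain (parent j ω) (pub j ω) Δ (T j ω k) (parent j ω k)
  -- a vote on a height goes to a proposer block of this height, and is possible only after the
  -- first proposer block of this height has been published
  vote_height : ∀ j ω b h p, 1 ≤ h → vote j ω b h = some p → blockHeight (parent 0 ω) p = h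
  vote_published : ∀ j ω b h p, 1 ≤ h → vote j ω b h = some p →
    ∃ q, blockHeight (parent 0 ω) q = h ∧ pub 0 ω q < (T j.succ ω b : EReal)
  -- an honest voter block votes on every height not voted on by its ancestors that had a
  -- published proposer block at least `Δ` before
  honest_votes : ∀ j ω b h, 1 ≤ h → honest j.succ ω b →
    (∃ q, blockHeight (parent 0 ω) q = h ∧ pub 0 ω q ≤ ((T j.succ ω b - Δ : ℝ) : EReal)) →
    (∀ i, 1 ≤ i → i ≤ blockHeight (parent j.succ ω) b →
      vote j ω ((parent j.succ ω)^[i] b) h = none) →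
    vote j ω b h ≠ none
  -- it chooses the first observed block of that height; every block is observed no earlier than
  -- its publication and at most `Δ` after
  honest_vote_first : ∀ j ω b h p, 1 ≤ h → honest j.succ ω b → vote j ω b h = some p →
    pub 0 ω p ≤ (T j.succ ω b : EReal) ∧
      ∀ q, blockHeight (parent 0 ω) q = h → pub 0 ω p ≤ pub 0 ω q + (Δ : EReal)
  -- honest mining: independent Poisson processes of rate `α`
  honest_poisson : ∀ j,
    IsPoissonProcess (fun (t : ℝ≥0) ω => minedCount (T j ω) (honest j ω) 0 t) α P
  honest_indep :
    iIndepFun (fun j ω (t : ℝ≥0) => minedCount (T j ω) (honest j ω) 0 t) P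
  -- adversarial mining: the number of blocks mined during `(s, t]` is dominated by a Poisson
  -- variable with parameter `β * (t - s)`
  adversarial_bound : ∀ (j : Fin (m + 1)) (s t : ℝ), 0 ≤ s → s < t → ∀ a : ℕ,
    Real.exp (-(β * (t - s))) *
        ∑ i ∈ Finset.range (a + 1), (β * (t - s)) ^ i / (i.factorial : ℝ) ≤
      P.real {ω | minedCount (T j ω) (fun k => ¬ honest j ω k) s t ≤ a}

namespace PrismModel

variable {Ω : Type*} [MeasurableSpace Ω] {P : Measure Ω} {m : ℕ} {α β Δ : ℝ}

/-- Height of block `k` of category `j`. -/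
def height (M : PrismModel P m α β Δ) (j : Fin (m + 1)) (ω : Ω) (k : ℕ) : ℕ :=
  blockHeight (M.parent j ω) k

/-- `t`-credible blockchains of category `j`. -/
def Credible (M : PrismModel P m α β Δ) (j : Fin (m + 1)) (ω : Ω) (t : ℝ) (b : ℕ) : Prop :=
  CredibleChain (M.parent j ω) (M.pub j ω) Δ t b

/-- A lagger is a non-genesis honest block which is the only honest block (the genesis block
included) mined during `[T k - Δ, T k]`. -/
def IsLagger (M : PrismModel P m α β Δ) (j : Fin (m + 1)) (ω : Ω) (k : ℕ) : Prop :=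
  1 ≤ k ∧ M.honest j ω k ∧
    ∀ i, M.honest j ω i → M.T j ω k - Δ ≤ M.T j ω i → M.T j ω i ≤ M.T j ω k → i = k

/-- A loner is a lagger which is also the only honest block mined during `[T k, T k + Δ]`. -/
def IsLoner (M : PrismModel P m α β Δ) (j : Fin (m + 1)) (ω : Ω) (k : ℕ) : Prop :=
  M.IsLagger j ω k ∧
    ∀ i, M.honest j ω i → M.T j ω k ≤ M.T j ω i → M.T j ω i ≤ M.T j ω k + Δ → i = k

/-- Number of honest blocks of category `j` mined during `(s, t]`. -/
def numHonest (M : PrismModel P m α β Δ) (j : Fin (m + 1)) (s t : ℝ) (ω : Ω) : ℕ :=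
  minedCount (M.T j ω) (M.honest j ω) s t

/-- Number of laggers of category `j` mined during `(s, t]`. -/
def numLagger (M : PrismModel P m α β Δ) (j : Fin (m + 1)) (s t : ℝ) (ω : Ω) : ℕ :=
  minedCount (M.T j ω) (M.IsLagger j ω) s t

/-- Number of loners of category `j` mined during `(s, t]`. -/
def numLoner (M : PrismModel P m α β Δ) (j : Fin (m + 1)) (s t : ℝ) (ω : Ω) : ℕ :=
  minedCount (M.T j ω) (M.IsLoner j ω) s t

/-- Number of adversarial blocks of category `j` mined during `(s, t]`. -/
def numAdversarial (M : PrismModel P m α β Δ) (j : Fin (m + 1)) (s t : ℝ) (ω : Ω) : ℕ :=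
  minedCount (M.T j ω) (fun k => ¬ M.honest j ω k) s t

/-- The propagation discount `g = exp (-α Δ)`. -/
def g (_M : PrismModel P m α β Δ) : ℝ := Real.exp (-(α * Δ))

/-- The `δ`-good event for category `j` with respect to the time interval `(s, t]`. -/
def goodEvent (M : PrismModel P m α β Δ) (δ : ℝ) (j : Fin (m + 1)) (s t : ℝ) : Set Ω :=
  {ω | ((1 - δ) * (t - s) * α < (M.numHonest j s t ω : ℝ) ∧
        (M.numHonest j s t ω : ℝ) < (1 + δ) * (t - s) * α) ∧
      (1 - δ) * (t - s) * M.g * α < (M.numLagger j s t ω : ℝ) ∧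
      (1 - δ) * (t - s) * M.g ^ 2 * α < (M.numLoner j s t ω : ℝ) ∧
      (M.numAdversarial j s t ω : ℝ) < (t - s) * β + (t - s) * M.g ^ 2 * α * δ}

/-- The `δ`-typical event for category `j` with respect to `(s, t]`: the good event occurs for
every interval `(a, b]` with `0 ≤ a ≤ s` and `t ≤ b`. -/
def typicalEvent (M : PrismModel P m α β Δ) (δ : ℝ) (j : Fin (m + 1)) (s t : ℝ) : Set Ω :=
  ⋂ a ∈ Set.Icc 0 s, ⋂ b ∈ Set.Ici t, M.goodEvent δ j a b

/-- The blockchain of voter category `j.succ` that ends in block `b` votes for proposer block `p`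
on height `h`. Only the first vote on height `h` along a blockchain, from the genesis block on,
is valid. -/
def ChainVotes (M : PrismModel P m α β Δ) (j : Fin m) (ω : Ω) (b h p : ℕ) : Prop :=
  ∃ i ≤ M.height j.succ ω b, M.vote j ω ((M.parent j.succ ω)^[i] b) h = some p ∧
    ∀ i', i < i' → i' ≤ M.height j.succ ω b →
      M.vote j ω ((M.parent j.succ ω)^[i'] b) h = none

/-- Number of votes that proposer block `p` receives on height `h` from the collection of voter
blockchains that end in the blocks `c j`. -/
def numVotes (M : PrismModel P m α β Δ) (ω : Ω) (c : Fin m → ℕ) (h p : ℕ) : ℕ :=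
  Set.ncard {j : Fin m | M.ChainVotes j ω (c j) h p}

/-- `(b 0, …, b n)` is a `t`-credible leader sequence: `b 0` is the genesis proposer block, `n` is
at least the height of every proposer blockchain published by time `t - Δ`, and for some
collection of `t`-credible voter blockchains, one for each voter category, `b l` is, for
`1 ≤ l ≤ n`, a proposer block with the most votes among all proposer blocks of height `l`
published by time `t` (ties may be broken in any way). Values of `b` beyond `n` are irrelevant. -/
def IsCredibleLeaderSeq (M : PrismModel P m α β Δ) (ω : Ω) (t : ℝ) (n : ℕ) (b : ℕ → ℕ) : Prop :=
  b 0 = 0 ∧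
  (∀ k, M.pub 0 ω k ≤ ((t - Δ : ℝ) : EReal) → M.height 0 ω k ≤ n) ∧
  ∃ c : Fin m → ℕ, (∀ j, M.Credible j.succ ω t (c j)) ∧
    ∀ l, 1 ≤ l → l ≤ n →
      M.height 0 ω (b l) = l ∧ M.pub 0 ω (b l) ≤ (t : EReal) ∧
      ∀ q, M.height 0 ω q = l → M.pub 0 ω q ≤ (t : EReal) →
        M.numVotes ω c l q ≤ M.numVotes ω c l (b l)

/-- Number of honest blocks among the last `k` blocks of `(b 0, …, b n)`, for `k ≤ n`. -/
def honestInLast (M : PrismModel P m α β Δ) (ω : Ω) (n : ℕ) (b : ℕ → ℕ) (k : ℕ) : ℕ :=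
  Set.ncard {l | n - k < l ∧ l ≤ n ∧ M.honest 0 ω (b l)}

/-- Number of adversarial blocks among the last `k` blocks of `(b 0, …, b n)`, for `k ≤ n`. -/
def adversarialInLast (M : PrismModel P m α β Δ) (ω : Ω) (n : ℕ) (b : ℕ → ℕ) (k : ℕ) : ℕ :=
  Set.ncard {l | n - k < l ∧ l ≤ n ∧ ¬ M.honest 0 ω (b l)}

/-- The exponent parameter `η = δ² g² α`. -/
def eta (M : PrismModel P m α β Δ) (δ : ℝ) : ℝ := δ ^ 2 * M.g ^ 2 * α

/-- The prefactor `μ = 9 exp (2 η / 27) / (1 - exp (-η / 27))²`. -/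
def mu (M : PrismModel P m α β Δ) (δ : ℝ) : ℝ :=
  9 * Real.exp (2 / 27 * M.eta δ) / (1 - Real.exp (-(1 / 27 * M.eta δ))) ^ 2

end PrismModel

end

/-! ### Counting blocks by mining time -/

/-! The first claim is pathwise. Put λ = (1 - 41/40 δ) g α. All honest blocks mined before a lagger
are visible to it, so each lagger raises the honest height by at least one
(`exists_honest_height_ge`). Hence an honest proposer block a mined by time t - k/λ forces n to
exceed its height h(a) by more than λ (t - T a); the delay Δ is paid for by δ/40. Taking a to be
genesis gives n ≥ k. On the other side, fewer than g λ (t - s) adversarial blocks are mined in (s,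
t] when s ≤ t - k/λ.

Now let A be the number of adversarial blocks among the last k leaders, and let a be the earliest
mined of their last honest ancestors. These A blocks are mined after a, and so are adversarial
blocks on all heights above h(a) up to n - k, so the adversary mined at least A + (n - k - h(a))
blocks in (T a, t] (`exists_honest_before_adversarial`). If a is mined after t - k/λ, comparison
with that window gives A < g k. Otherwise y = λ (t - T a) ≥ k and A < g y + k - y ≤ g k, because g ≤
1. The argument covers any choice of one published block per height.

It remains to bound the failure probability of the typical event. Rounding both endpoints reduces it
to countably many pairs of an inner and an outer interval (`compl_typicalEvent_subset`), and
exponential tails sum to a double geometric series. Honest and adversarial counts have Chernoff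
bounds for Poisson variables. Laggers and loners of nearby times are dependent, so time is cut into
short slots with independent Poisson counts: a run of empty slots, a slot with one block and
possibly another empty run certify a lagger or loner. Blocks of slots of total length 3Δ are
independent and detect what happens in their middle third; three shifted phases make the middle
thirds tile the time axis (`pattern_lower_tail`). The phases cost a factor 3 in front and 1/3 in the
exponent, whence 9 = 1 + 1 + 1 + 3 + 3 and 27 = 3 · 9. -/

lemma finite_setOf_mined {T : ℕ → ℝ} (hT : Filter.Tendsto T Filter.atTop Filter.atTop)
    (H : ℕ → Prop) (s t : ℝ) : {k | H k ∧ s < T k ∧ T k ≤ t}.Finite := by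
  obtain ⟨n, hn⟩ := Filter.eventually_atTop.1 (hT.eventually_gt_atTop t)
  refine (Set.finite_lt_nat n).subset fun k hk => ?_
  by_contra h
  exact absurd hk.2.2 (not_le.2 (hn k (not_lt.1 h)))

lemma minedCount_mono {T : ℕ → ℝ} (hT : Filter.Tendsto T Filter.atTop Filter.atTop)
    (H : ℕ → Prop) {s s' t t' : ℝ} (hs : s' ≤ s) (ht : t ≤ t') :
    minedCount T H s t ≤ minedCount T H s' t' :=
  Set.ncard_le_ncard (fun _ hk => ⟨hk.1, hs.trans_lt hk.2.1, hk.2.2.trans ht⟩)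
    (finite_setOf_mined hT H s' t')

lemma minedCount_add {T : ℕ → ℝ} (hT : Filter.Tendsto T Filter.atTop Filter.atTop)
    (H : ℕ → Prop) {s u t : ℝ} (hsu : s ≤ u) (hut : u ≤ t) :
    minedCount T H s u + minedCount T H u t = minedCount T H s t := by
  unfold minedCount
  rw [← Set.ncard_union_eq _ (finite_setOf_mined hT H s u) (finite_setOf_mined hT H u t)]
  · congr 1
    ext k
    simp only [Set.mem_union, Set.mem_ofPred_eq]
    constructor
    · rintro (⟨h1, h2, h3⟩ | ⟨h1, h2, h3⟩)
      exacts [⟨h1, h2, h3.trans hut⟩, ⟨h1, hsu.trans_lt h2, h3⟩]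
    · rintro ⟨h1, h2, h3⟩
      rcases le_or_gt (T k) u with h | h
      exacts [Or.inl ⟨h1, h2, h⟩, Or.inr ⟨h1, h, h3⟩]
  · rw [Set.disjoint_left]
    rintro k ⟨-, -, h⟩ ⟨-, h', -⟩
    exact absurd h (not_le.2 h')

/-- If blocks indexed by a finite set are distinct, have property `H` and are mined in `(s, t]`,
then there are at most `minedCount T H s t` of them. -/
lemma card_le_minedCount {T : ℕ → ℝ} (hT : Filter.Tendsto T Filter.atTop Filter.atTop)
    {H : ℕ → Prop} {s t : ℝ} {ι : Type*} (F : Finset ι) (f : ι → ℕ) (hf : Set.InjOn f F)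
    (h : ∀ i ∈ F, H (f i) ∧ s < T (f i) ∧ T (f i) ≤ t) : F.card ≤ minedCount T H s t := by
  classical
  rw [← Finset.card_image_of_injOn hf, ← Set.ncard_coe_finset]
  refine Set.ncard_le_ncard ?_ (finite_setOf_mined hT H s t)
  intro k hk
  obtain ⟨i, hi, rfl⟩ := Finset.mem_image.1 (Finset.mem_coe.1 hk)
  exact h i hi

/-- The count is at least `a` exactly when some `a`-element set of block numbers consists of counted
blocks, so this event is a countable union of finite intersections. -/
lemma measurable_minedCount {Ω : Type*} [MeasurableSpace Ω] {T : Ω → ℕ → ℝ} {H : Ω → ℕ → Prop}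
    (hT : ∀ ω, Filter.Tendsto (T ω) Filter.atTop Filter.atTop)
    (mT : ∀ k, Measurable fun ω => T ω k) (mH : ∀ k, MeasurableSet {ω | H ω k}) (s t : ℝ) :
    Measurable fun ω => minedCount (T ω) (H ω) s t := by
  have key : ∀ a : ℕ, MeasurableSet {ω | a ≤ minedCount (T ω) (H ω) s t} := by
    intro a
    have : {ω | a ≤ minedCount (T ω) (H ω) s t} =
        ⋃ F : {F : Finset ℕ // F.card = a}, ⋂ k ∈ F.1,
          ({ω | H ω k} ∩ {ω | s < T ω k} ∩ {ω | T ω k ≤ t}) := by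
      ext ω
      simp only [Set.mem_ofPred_eq, Set.mem_iUnion, Set.mem_iInter, Set.mem_inter_iff]
      constructor
      · intro h
        have hfin := finite_setOf_mined (hT ω) (H ω) s t
        unfold minedCount at h
        rw [Set.ncard_eq_toFinset_card _ hfin] at h
        obtain ⟨F, hF, hc⟩ := Finset.exists_subset_card_eq h
        refine ⟨⟨F, hc⟩, fun k hk => ?_⟩
        have := hfin.mem_toFinset.1 (hF hk)
        exact ⟨⟨this.1, this.2.1⟩, this.2.2⟩
      · rintro ⟨⟨F, rfl⟩, h⟩
        exact card_le_minedCount (hT ω) F id (Set.injOn_id _)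
          fun k hk => ⟨(h k hk).1.1, (h k hk).1.2, (h k hk).2⟩
    rw [this]
    refine MeasurableSet.iUnion fun F => Finset.measurableSet_biInter _ fun k _ => ?_
    exact ((mH k).inter (measurableSet_lt measurable_const (mT k))).inter
      (measurableSet_le (mT k) measurable_const)
  refine measurable_of_Ici fun a => key a

/-! ### Heights -/

lemma exists_iterate_eq_zero {f : ℕ → ℕ} (hf : ∀ k, 1 ≤ k → f k < k) (k : ℕ) :
    ∃ i, f^[i] k = 0 := by
  induction k using Nat.strong_induction_on with
  | _ k ih =>
    rcases Nat.eq_zero_or_pos k with rfl | hk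
    · exact ⟨0, rfl⟩
    · obtain ⟨i, hi⟩ := ih (f k) (hf k hk)
      exact ⟨i + 1, hi⟩

lemma blockHeight_zero (f : ℕ → ℕ) : blockHeight f 0 = 0 :=
  Nat.sInf_eq_zero.2 (Or.inl rfl)

lemma blockHeight_eq_add_one {f : ℕ → ℕ} (hf : ∀ k, 1 ≤ k → f k < k) {k : ℕ} (hk : 1 ≤ k) :
    blockHeight f k = blockHeight f (f k) + 1 := by
  have h1 : f^[blockHeight f k] k = 0 := Nat.sInf_mem (exists_iterate_eq_zero hf k)
  have h2 : f^[blockHeight f (f k)] (f k) = 0 := Nat.sInf_mem (exists_iterate_eq_zero hf (f k))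
  apply le_antisymm
  · exact Nat.sInf_le h2
  · rcases hn : blockHeight f k with _ | n
    · rw [hn] at h1
      simp at h1
      omega
    · rw [hn] at h1
      exact Nat.succ_le_succ (Nat.sInf_le h1)

/-! ### Pathwise part: chain growth and the quality of leader sequences -/

namespace PrismModel

variable {Ω : Type*} [MeasurableSpace Ω] {P : Measure Ω} {m : ℕ} {α β Δ : ℝ}

lemma height_eq_add_one (M : PrismModel P m α β Δ) (j : Fin (m + 1)) (ω : Ω) {k : ℕ}
    (hk : 1 ≤ k) : M.height j ω k = M.height j ω (M.parent j ω k) + 1 :=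
  blockHeight_eq_add_one (M.parent_lt j ω) hk

lemma T_nonneg (M : PrismModel P m α β Δ) (j : Fin (m + 1)) (ω : Ω) (k : ℕ) :
    0 ≤ M.T j ω k := by
  rcases Nat.eq_zero_or_pos k with rfl | hk
  · exact (M.T_genesis j ω).ge
  · exact (M.T_pos j ω k hk).le

/-- Every lagger mined after an honest block adds at least one to the height that honest blocks
have reached. -/
lemma exists_honest_height_ge (M : PrismModel P m α β Δ) (j : Fin (m + 1)) (ω : Ω)
    {a : ℕ} (ha : M.honest j ω a) (c : ℕ) (u : ℝ) (hu : M.T j ω a ≤ u)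
    (hc : c ≤ M.numLagger j (M.T j ω a) u ω) :
    ∃ k, M.honest j ω k ∧ M.T j ω k ≤ u ∧ M.height j ω a + c ≤ M.height j ω k := by
  induction c generalizing u with
  | zero => exact ⟨a, ha, hu, le_rfl⟩
  | succ c ih =>
    set S := {k | M.IsLagger j ω k ∧ M.T j ω a < M.T j ω k ∧ M.T j ω k ≤ u} with hS
    have hfin : S.Finite := finite_setOf_mined (M.T_tendsto j ω) _ _ _
    have hcS : c + 1 ≤ S.ncard := hc
    have hne : S.Nonempty := by
      apply Set.nonempty_of_ncard_ne_zero
      omega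
    -- Split off the last lagger. Being alone in the preceding `Δ`, it leaves `a` and all other
    -- laggers at times up to `T l - Δ`, where induction applies; the block found there is visible
    -- to `l`, whose parent is therefore no lower.
    obtain ⟨l, hl, hmax⟩ := Set.exists_max_image S (M.T j ω) hfin hne
    obtain ⟨⟨hl1, hlh, hlone⟩, hal, hlu⟩ := hl
    have hau : M.T j ω a ≤ M.T j ω l - Δ := by
      by_contra h
      have := hlone a ha (not_le.1 h).le hal.le
      rw [this] at hal
      exact lt_irrefl _ hal
    have hc' : c ≤ M.numLagger j (M.T j ω a) (M.T j ω l - Δ) ω := by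
      have h1 : S.ncard ≤ (S \ {l}).ncard + 1 := by
        have := Set.pred_ncard_le_ncard_sdiff_singleton S l
        omega
      have h2 : (S \ {l}).ncard ≤ M.numLagger j (M.T j ω a) (M.T j ω l - Δ) ω := by
        refine Set.ncard_le_ncard ?_ (finite_setOf_mined (M.T_tendsto j ω) _ _ _)
        rintro i ⟨hi, hil⟩
        refine ⟨hi.1, hi.2.1, ?_⟩
        by_contra h
        exact hil (hlone i hi.1.2.1 (not_le.1 h).le (hmax i hi))
      omega
    obtain ⟨k, hk, hkT, hkh⟩ := ih _ hau hc'
    refine ⟨l, hlh, hlu, ?_⟩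
    have hcred := (M.honest_parent j ω l hl1 hlh).2 k (by
      rw [M.honest_pub j ω k hk]
      exact_mod_cast hkT)
    have := M.height_eq_add_one j ω hl1
    have hcred' : M.height j ω k ≤ M.height j ω (M.parent j ω l) := hcred
    omega

/-- Above its last honest ancestor, a blockchain has adversarial blocks on all heights. -/
lemma exists_honest_ancestor (M : PrismModel P m α β Δ) (j : Fin (m + 1)) (ω : Ω) (k : ℕ)
    (hk : ¬ M.honest j ω k) :
    ∃ a, M.honest j ω a ∧ M.T j ω a < M.T j ω k ∧
      ∀ x, M.height j ω a < x → x ≤ M.height j ω k →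
        ∃ c, ¬ M.honest j ω c ∧ M.height j ω c = x ∧ M.T j ω a < M.T j ω c ∧
          M.T j ω c ≤ M.T j ω k := by
  induction k using Nat.strong_induction_on with
  | _ k ih =>
    have hk1 : 1 ≤ k := by
      rcases Nat.eq_zero_or_pos k with rfl | h
      · exact absurd (M.honest_genesis j ω) hk
      · exact h
    have hh := M.height_eq_add_one j ω hk1
    have hT := M.T_parent_lt j ω k hk1
    by_cases hp : M.honest j ω (M.parent j ω k)
    · refine ⟨_, hp, hT, fun x hx hx' => ⟨k, hk, by omega, hT, le_rfl⟩⟩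
    · obtain ⟨a, ha, haT, hx⟩ := ih _ (M.parent_lt j ω k hk1) hp
      refine ⟨a, ha, haT.trans hT, fun x h1 h2 => ?_⟩
      rcases Nat.lt_or_ge (M.height j ω (M.parent j ω k)) x with h | h
      · exact ⟨k, hk, by omega, haT.trans hT, le_rfl⟩
      · obtain ⟨c, hc1, hc2, hc3, hc4⟩ := hx x h1 h
        exact ⟨c, hc1, hc2, hc3, hc4.trans hT.le⟩

lemma honestInLast_add_adversarialInLast (M : PrismModel P m α β Δ) (ω : Ω) {n k : ℕ}
    (b : ℕ → ℕ) (hkn : k ≤ n) :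
    M.honestInLast ω n b k + M.adversarialInLast ω n b k = k := by
  unfold honestInLast adversarialInLast
  have hfin : (Set.Ioc (n - k) n).Finite := Set.finite_Ioc _ _
  rw [← Set.ncard_union_eq _ (hfin.subset fun l hl => ⟨hl.1, hl.2.1⟩)
    (hfin.subset fun l hl => ⟨hl.1, hl.2.1⟩)]
  · have : {l | n - k < l ∧ l ≤ n ∧ M.honest 0 ω (b l)} ∪
        {l | n - k < l ∧ l ≤ n ∧ ¬ M.honest 0 ω (b l)} = Set.Ioc (n - k) n := by
      ext l
      simp only [Set.mem_union, Set.mem_ofPred_eq, Set.mem_Ioc]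
      tauto
    rw [this, ← Finset.coe_Ioc, Set.ncard_coe_finset, Nat.card_Ioc]
    omega
  · rw [Set.disjoint_left]
    rintro l ⟨-, -, h⟩ ⟨-, -, h'⟩
    exact h' h

/-- The adversarial blocks among the last `k` blocks of a leader sequence are all mined after some
honest block `a`, and on the heights between `a` and the last `k` there are further
adversarial blocks. -/
lemma exists_honest_before_adversarial (M : PrismModel P m α β Δ) (ω : Ω) {t : ℝ} {n k : ℕ}
    {b : ℕ → ℕ} (hb : ∀ l, 1 ≤ l → l ≤ n → M.height 0 ω (b l) = l ∧ M.pub 0 ω (b l) ≤ (t : EReal))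
    (hpos : 0 < M.adversarialInLast ω n b k) :
    ∃ a, M.honest 0 ω a ∧ M.T 0 ω a ≤ t ∧
      M.adversarialInLast ω n b k + (n - k - M.height 0 ω a) ≤
        M.numAdversarial 0 (M.T 0 ω a) t ω := by
  classical
  set S := {l | n - k < l ∧ l ≤ n ∧ ¬ M.honest 0 ω (b l)} with hS
  have hfin : S.Finite := (Set.finite_Ioc (n - k) n).subset fun l hl => ⟨hl.1, hl.2.1⟩
  have hne : S.Nonempty := Set.nonempty_of_ncard_ne_zero hpos.ne'
  have hanc : ∀ l, ∃ a, l ∈ S → M.honest 0 ω a ∧ M.T 0 ω a < M.T 0 ω (b l) ∧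
      ∀ x, M.height 0 ω a < x → x ≤ M.height 0 ω (b l) →
        ∃ c, ¬ M.honest 0 ω c ∧ M.height 0 ω c = x ∧ M.T 0 ω a < M.T 0 ω c ∧
          M.T 0 ω c ≤ M.T 0 ω (b l) := by
    intro l
    by_cases hl : l ∈ S
    · obtain ⟨a, ha⟩ := M.exists_honest_ancestor 0 ω (b l) hl.2.2
      exact ⟨a, fun _ => ha⟩
    · exact ⟨0, fun h => absurd h hl⟩
  choose a ha using hanc
  -- The earliest of the honest ancestors precedes all adversarial leaders at once.
  obtain ⟨l, hl, hmin⟩ := Set.exists_min_image S (fun l => M.T 0 ω (a l)) hfin hne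
  have hTt : ∀ l ∈ S, M.T 0 ω (b l) ≤ t := fun l hl => by
    have := (M.T_le_pub 0 ω (b l)).trans (hb l (by have := hl.1; omega) hl.2.1).2
    exact_mod_cast this
  obtain ⟨ha1, ha2, ha3⟩ := ha l hl
  have hbl := (hb l (by have := hl.1; omega) hl.2.1).1
  have hc : ∀ x, ∃ c, M.height 0 ω (a l) < x → x ≤ n - k → ¬ M.honest 0 ω c ∧
      M.height 0 ω c = x ∧ M.T 0 ω (a l) < M.T 0 ω c ∧ M.T 0 ω c ≤ t := by
    intro x
    by_cases hx : M.height 0 ω (a l) < x ∧ x ≤ n - k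
    · obtain ⟨c, h1, h2, h3, h4⟩ := ha3 x hx.1 (by have := hl.1; omega)
      exact ⟨c, fun _ _ => ⟨h1, h2, h3, h4.trans (hTt l hl)⟩⟩
    · exact ⟨0, fun h h' => absurd ⟨h, h'⟩ hx⟩
  choose c hc using hc
  refine ⟨a l, ha1, ha2.le.trans (hTt l hl), ?_⟩
  -- Heights serve as indices: leaders occupy some of the heights above `n - k`, the blocks `c x`
  -- those below. Distinct heights make the blocks distinct, so nothing is counted twice.
  set F : Finset ℕ := hfin.toFinset ∪ Finset.Ioc (M.height 0 ω (a l)) (n - k) with hF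
  have hcard : F.card = M.adversarialInLast ω n b k + (n - k - M.height 0 ω (a l)) := by
    rw [hF, Finset.card_union_of_disjoint, Nat.card_Ioc]
    · congr 1
      exact (Set.ncard_eq_toFinset_card S hfin).symm
    · rw [Finset.disjoint_left]
      intro x hx hx'
      have h1 := (hfin.mem_toFinset.1 hx).1
      have h2 := (Finset.mem_Ioc.1 hx').2
      omega
  rw [← hcard]
  have hprop : ∀ x ∈ F, (¬ M.honest 0 ω (if x ∈ S then b x else c x) ∧
      M.T 0 ω (a l) < M.T 0 ω (if x ∈ S then b x else c x) ∧
      M.T 0 ω (if x ∈ S then b x else c x) ≤ t) ∧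
      M.height 0 ω (if x ∈ S then b x else c x) = x := by
    intro x hx
    split_ifs with hxS
    · exact ⟨⟨hxS.2.2, (hmin x hxS).trans_lt (ha x hxS).2.1, hTt x hxS⟩,
        (hb x (by have := hxS.1; omega) hxS.2.1).1⟩
    · rcases Finset.mem_union.1 hx with h | h
      · exact absurd (hfin.mem_toFinset.1 h) hxS
      · rw [Finset.mem_Ioc] at h
        obtain ⟨h1, h2, h3, h4⟩ := hc x h.1 h.2
        exact ⟨⟨h1, h3, h4⟩, h2⟩
  refine card_le_minedCount (M.T_tendsto 0 ω) F (fun x => if x ∈ S then b x else c x) ?_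
    fun x hx => (hprop x hx).1
  intro x hx y hy hxy
  have h1 := (hprop x hx).2
  have h2 := (hprop y hy).2
  simp only at hxy
  rw [← h1, ← h2, hxy]

lemma g_pos (M : PrismModel P m α β Δ) : 0 < M.g := Real.exp_pos _

lemma g_le_one (M : PrismModel P m α β Δ) (hα : 0 < α) (hΔ : 0 < Δ) : M.g ≤ 1 := by
  unfold g
  rw [Real.exp_le_one_iff]
  have := mul_pos hα hΔ
  linarith

lemma goodEvent_of_typicalEvent (M : PrismModel P m α β Δ) {δ : ℝ} {j : Fin (m + 1)} {s t a b : ℝ}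
    {ω : Ω} (h : ω ∈ M.typicalEvent δ j s t) (ha : 0 ≤ a) (has : a ≤ s) (hb : t ≤ b) :
    ω ∈ M.goodEvent δ j a b := by
  simp only [typicalEvent, Set.mem_iInter] at h
  exact h a ⟨ha, has⟩ b hb

/-- Leader sequence quality under the typical event. -/
theorem leaderSeq_quality (M : PrismModel P m α β Δ) {δ : ℝ} (hα : 1 / 2 < α) (hΔ : 0 < Δ)
    (hδ : 0 < δ) (hδ' : δ < 40 / 81) (hrate : β < (1 - 81 / 40 * δ) * M.g ^ 2 * α)
    {k : ℕ} {t : ℝ} (hk : 160 * α * (1 + Δ) / δ ≤ (k : ℝ))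
    (ht : (k : ℝ) / ((1 - 41 / 40 * δ) * M.g * α) ≤ t) {ω : Ω}
    (hω : ω ∈ M.typicalEvent δ 0 (t - (k : ℝ) / (2 * α) + Δ) (t - Δ)) {n : ℕ} {b : ℕ → ℕ}
    (hn : ∀ k, M.pub 0 ω k ≤ ((t - Δ : ℝ) : EReal) → M.height 0 ω k ≤ n)
    (hb : ∀ l, 1 ≤ l → l ≤ n → M.height 0 ω (b l) = l ∧ M.pub 0 ω (b l) ≤ (t : EReal)) :
    k ≤ n ∧ (M.adversarialInLast ω n b k : ℝ) ≤ M.g * k := by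
  have hα0 : 0 < α := by linarith
  have hg := M.g_pos
  have hg1 := M.g_le_one hα0 hΔ
  set g := M.g
  have hκ : 0 < 1 - 41 / 40 * δ := by linarith
  have hκg : 0 < (1 - 41 / 40 * δ) * g * α := by positivity
  -- The time in which growth at the guaranteed rate amounts to `k` heights.
  set w : ℝ := (k : ℝ) / ((1 - 41 / 40 * δ) * g * α) with hw
  have hwk : w * ((1 - 41 / 40 * δ) * g * α) = k := div_mul_cancel₀ _ hκg.ne'
  have hk' : 160 * α * (1 + Δ) ≤ k * δ := (div_le_iff₀ hδ).1 hk
  have hk0 : (0 : ℝ) ≤ k := Nat.cast_nonneg k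
  -- the window is long in comparison with the delay
  have hwα : (k : ℝ) / α ≤ w := by
    rw [hw]
    apply div_le_div_of_nonneg_left hk0 hκg
    have : (1 - 41 / 40 * δ) * g ≤ 1 := by nlinarith
    nlinarith
  have hwΔ : 160 * (1 + Δ) ≤ w * δ := by
    have h1 : 160 * (1 + Δ) ≤ (k : ℝ) / α * δ := by
      rw [div_mul_eq_mul_div, le_div_iff₀ hα0]
      linarith
    nlinarith
  have hw0 : 0 ≤ w := by
    rw [hw]
    positivity
  have hwin : k / (2 * α) ≤ w := by
    refine le_trans ?_ hwα
    apply div_le_div_of_nonneg_left hk0 hα0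
    linarith
  -- Since `160 * (1 + Δ) ≤ w * δ`, the loss of `Δ` is covered by a fortieth of `δ`.
  have slack : ∀ y, w ≤ y → (1 - 41 / 40 * δ) * y ≤ (1 - δ) * (y - Δ) := by
    intro y hy
    nlinarith
  -- Laggers are counted only up to `t - Δ`, because a block bounds `n` from below only if it is
  -- published by then.
  have growth : ∀ a, M.honest 0 ω a → M.T 0 ω a ≤ t - w →
      (M.height 0 ω a : ℝ) + (1 - 41 / 40 * δ) * (t - M.T 0 ω a) * g * α < n := by
    intro a ha haT
    have hE := (M.goodEvent_of_typicalEvent hω (M.T_nonneg 0 ω a)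
      (b := t - Δ) (by linarith) le_rfl).2.1
    obtain ⟨q, hq, hqT, hqh⟩ := M.exists_honest_height_ge 0 ω ha _ (t - Δ) (by nlinarith) le_rfl
    have hqn := hn q (by rw [M.honest_pub 0 ω q hq]; exact_mod_cast hqT)
    have h1 : (M.height 0 ω a : ℝ) + M.numLagger 0 (M.T 0 ω a) (t - Δ) ω ≤ n := by
      exact_mod_cast hqh.trans hqn
    have h2 := slack (t - M.T 0 ω a) (by linarith)
    have h3 : (1 - 41 / 40 * δ) * (t - M.T 0 ω a) * (g * α) ≤
        (1 - δ) * (t - M.T 0 ω a - Δ) * (g * α) :=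
      mul_le_mul_of_nonneg_right h2 (by positivity)
    have h4 : (1 - δ) * (t - Δ - M.T 0 ω a) * g * α <
      (M.numLagger 0 (M.T 0 ω a) (t - Δ) ω : ℝ) := hE
    nlinarith
  have hkn : k ≤ n := by
    have h := growth 0 (M.honest_genesis 0 ω) (by rw [M.T_genesis]; linarith)
    have h0 : M.height 0 ω 0 = 0 := blockHeight_zero _
    rw [M.T_genesis, h0] at h
    have h2 : w * ((1 - 41 / 40 * δ) * g * α) ≤ t * ((1 - 41 / 40 * δ) * g * α) :=
      mul_le_mul_of_nonneg_right ht hκg.le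
    have : (k : ℝ) < n := by
      push_cast at h
      nlinarith
    exact_mod_cast this.le
  refine ⟨hkn, ?_⟩
  rcases Nat.eq_zero_or_pos (M.adversarialInLast ω n b k) with h0 | hpos
  · rw [h0]
    push_cast
    positivity
  obtain ⟨a, ha, hat, hA⟩ := M.exists_honest_before_adversarial ω hb hpos
  -- Here 81/40 = 41/40 + 1: the good event loses one `δ` on top of `β`, which leaves `g` times the
  -- growth rate.
  have hadv : ∀ s, 0 ≤ s → s ≤ t - w →
      (M.numAdversarial 0 s t ω : ℝ) < (t - s) * ((1 - 41 / 40 * δ) * g * α) * g := by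
    intro s hs hst
    have hE := (M.goodEvent_of_typicalEvent hω hs (b := t) (by linarith) (by linarith)).2.2.2
    have h1 : (t - s) * β ≤ (t - s) * ((1 - 81 / 40 * δ) * g ^ 2 * α) :=
      mul_le_mul_of_nonneg_left hrate.le (by linarith)
    have hE' : (M.numAdversarial 0 s t ω : ℝ) < (t - s) * β + (t - s) * g ^ 2 * α * δ := hE
    nlinarith
  -- If `a` lies in the window, the window alone bounds the count. Otherwise going further back
  -- allows more adversarial blocks, but the heights to be filled below the last `k` grow faster.
  rcases le_or_gt (t - w) (M.T 0 ω a) with h | h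
  · have h1 := hadv (t - w) (by linarith) le_rfl
    have h2 : M.numAdversarial 0 (M.T 0 ω a) t ω ≤ M.numAdversarial 0 (t - w) t ω :=
      minedCount_mono (M.T_tendsto 0 ω) _ h le_rfl
    have h3 : (M.adversarialInLast ω n b k : ℝ) ≤ M.numAdversarial 0 (t - w) t ω := by
      exact_mod_cast (by omega : M.adversarialInLast ω n b k ≤ M.numAdversarial 0 (t - w) t ω)
    have h4 : (t - (t - w)) * ((1 - 41 / 40 * δ) * g * α) * g = g * k := by
      rw [sub_sub_cancel, hwk, mul_comm]
    linarith
  · have h1 := hadv _ (M.T_nonneg 0 ω a) h.le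
    have h2 := growth a ha h.le
    have h3 : w * ((1 - 41 / 40 * δ) * g * α) ≤ (t - M.T 0 ω a) * ((1 - 41 / 40 * δ) * g * α) :=
      mul_le_mul_of_nonneg_right (by linarith) hκg.le
    have h4 : (M.adversarialInLast ω n b k : ℝ) + (n - k - M.height 0 ω a) ≤
        M.numAdversarial 0 (M.T 0 ω a) t ω := by
      have : M.adversarialInLast ω n b k + n ≤
          M.numAdversarial 0 (M.T 0 ω a) t ω + k + M.height 0 ω a := by omega
      have : (M.adversarialInLast ω n b k + n : ℝ) ≤
          M.numAdversarial 0 (M.T 0 ω a) t ω + k + M.height 0 ω a := by exact_mod_cast this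
      linarith
    set y := (t - M.T 0 ω a) * ((1 - 41 / 40 * δ) * g * α) with hy
    have h5 : (M.height 0 ω a : ℝ) + y < n := by
      have : (1 - 41 / 40 * δ) * (t - M.T 0 ω a) * g * α = y := by rw [hy]; ring
      linarith
    have h6 : (k : ℝ) * (1 - g) ≤ y * (1 - g) :=
      mul_le_mul_of_nonneg_right (hwk.symm.le.trans h3) (sub_nonneg.2 hg1)
    rw [mul_one_sub, mul_one_sub, mul_comm (k : ℝ) g] at h6
    linarith

end PrismModel

/-! ### Tails of the Poisson distribution -/

lemma hasSum_exp_mul_poisson (r : ℝ≥0) (θ : ℝ) :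
    HasSum (fun n : ℕ => Real.exp (-r) * (r : ℝ) ^ n / n.factorial * Real.exp (θ * n))
      (Real.exp (r * (Real.exp θ - 1))) := by
  convert! (NormedSpace.expSeries_div_hasSum_exp ((r : ℝ) * Real.exp θ)).mul_left
    (Real.exp (-r)) using 1
  · ext n
    rw [mul_pow, ← Real.exp_nat_mul, mul_comm (n : ℝ) θ]
    ring
  · rw [← Real.exp_eq_exp_ℝ, ← Real.exp_add]
    ring_nf

lemma integrable_exp_mul_poisson (r : ℝ≥0) (θ : ℝ) :
    Integrable (fun n : ℕ => Real.exp (θ * n)) (poissonMeasure r) := by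
  rw [integrable_poissonMeasure_iff]
  simpa only [Real.norm_eq_abs, Real.abs_exp] using (hasSum_exp_mul_poisson r θ).summable

lemma mgf_poisson (r : ℝ≥0) (θ : ℝ) :
    mgf (fun n : ℕ => (n : ℝ)) (poissonMeasure r) θ = Real.exp (r * (Real.exp θ - 1)) := by
  unfold mgf
  rw [integral_poissonMeasure]
  simpa only [smul_eq_mul] using (hasSum_exp_mul_poisson r θ).tsum_eq

lemma poisson_upper_tail (r : ℝ≥0) (y : ℝ) {θ : ℝ} (hθ : 0 ≤ θ) :
    (poissonMeasure r).real {n : ℕ | y ≤ n} ≤ Real.exp (-θ * y + r * (Real.exp θ - 1)) := by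
  rw [Real.exp_add, ← mgf_poisson]
  exact measure_ge_le_exp_mul_mgf y hθ (integrable_exp_mul_poisson r θ)

lemma poisson_lower_tail (r : ℝ≥0) (y : ℝ) {θ : ℝ} (hθ : 0 ≤ θ) :
    (poissonMeasure r).real {n : ℕ | (n : ℝ) ≤ y} ≤
      Real.exp (θ * y + r * (Real.exp (-θ) - 1)) := by
  rw [Real.exp_add, ← mgf_poisson]
  have := measure_le_le_exp_mul_mgf y (neg_nonpos.2 hθ) (integrable_exp_mul_poisson r (-θ))
  rwa [neg_neg] at this

/-- If the distribution function of `Z` dominates that of a Poisson variable, then the upper tail of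
`Z` is dominated by the Poisson tail. -/
lemma upper_tail_le_poisson {Ω : Type*} [MeasurableSpace Ω] {P : Measure Ω}
    [IsProbabilityMeasure P] {Z : Ω → ℕ} (hZ : Measurable Z) (r : ℝ≥0)
    (h : ∀ a : ℕ, Real.exp (-r) * ∑ i ∈ Finset.range (a + 1), (r : ℝ) ^ i / (i.factorial : ℝ) ≤
      P.real {ω | Z ω ≤ a}) {y : ℝ} (hy : 0 < y) :
    P.real {ω | y ≤ Z ω} ≤ (poissonMeasure r).real {n : ℕ | y ≤ n} := by
  -- Positivity of `y` makes its ceiling a successor, so `y ≤ n` is the complement of `n ≤ a`, where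
  -- the hypothesis applies.
  obtain ⟨a, ha⟩ : ∃ a : ℕ, ⌈y⌉₊ = a + 1 :=
    Nat.exists_eq_succ_of_ne_zero (Nat.ceil_pos.2 hy).ne'
  have hiff : ∀ n : ℕ, y ≤ n ↔ ¬ n ≤ a := by
    intro n
    rw [← Nat.ceil_le, ha]
    omega
  have h1 : {ω | y ≤ Z ω} = {ω | Z ω ≤ a}ᶜ := by
    ext ω
    exact hiff _
  have h2 : {n : ℕ | y ≤ n} = (↑(Finset.range (a + 1)) : Set ℕ)ᶜ := by
    ext n
    simp [hiff]
  rw [h1, h2, probReal_compl_eq_one_sub (measurableSet_le hZ measurable_const),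
    probReal_compl_eq_one_sub (Finset.measurableSet _), ← sum_measureReal_singleton]
  refine sub_le_sub_left (le_trans (le_of_eq ?_) (h a)) _
  rw [Finset.mul_sum]
  refine Finset.sum_congr rfl fun i _ => ?_
  rw [poissonMeasure_real_singleton, mul_div_assoc]

/-! ### Patterns in sequences of independent Poisson variables -/

/-- A sequence of slots contains, starting in one of the first `D` slots, the pattern consisting
of `D` empty slots, one slot with value `1`, and `e` empty slots. -/
def SlotPattern (D e : ℕ) (x : ℕ → ℕ) : Prop :=
  ∃ i < D, x (D + i) = 1 ∧ (∀ j, i ≤ j → j < D + i → x j = 0) ∧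
    ∀ j, D + i < j → j ≤ D + i + e → x j = 0

/-- A pattern starting at `i < D` ends in slot `D + i + e`, which is at most `3 * D - 1` when `e ≤
D`. -/
lemma SlotPattern.congr {D e : ℕ} (he : e ≤ D) {x y : ℕ → ℕ} (h : ∀ j < 3 * D, x j = y j) :
    SlotPattern D e x ↔ SlotPattern D e y := by
  unfold SlotPattern
  refine exists_congr fun i => and_congr_right fun hi => ?_
  rw [h (D + i) (by omega)]
  refine and_congr_right fun _ => and_congr ?_ ?_
  · refine forall_congr' fun j => forall₂_congr fun h1 h2 => ?_
    rw [h j (by omega)]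
  · refine forall_congr' fun j => forall₂_congr fun h1 h2 => ?_
    rw [h j (by omega)]

open Classical in
/-- Number of the first `K` blocks of `3 * D` slots, counted from slot `o`, that contain the
pattern. -/
noncomputable def patternCount {Ω : Type*} (v : ℕ → Ω → ℕ) (D e o K : ℕ) (ω : Ω) : ℕ :=
  ((Finset.range K).filter fun b => SlotPattern D e fun j => v (o + 3 * D * b + j) ω).card

lemma patternCount_succ {Ω : Type*} (v : ℕ → Ω → ℕ) (D e o K : ℕ) (ω : Ω) :
    (patternCount v D e o (K + 1) ω : ℝ) = patternCount v D e o K ω +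
      Set.indicator {ω | SlotPattern D e fun j => v (o + 3 * D * K + j) ω} (fun _ => (1 : ℝ)) ω := by
  classical
  unfold patternCount
  rw [Finset.range_add_one, Finset.filter_insert]
  by_cases h : SlotPattern D e fun j => v (o + 3 * D * K + j) ω
  · rw [if_pos h, Finset.card_insert_of_notMem (by simp)]
    simp [Set.indicator, h]
  · rw [if_neg h]
    simp [Set.indicator, h]

section Pattern

variable {Ω : Type*} [MeasurableSpace Ω] {P : Measure Ω}
  {v : ℕ → Ω → ℕ} {ρ : ℝ≥0}

lemma measurableSet_slotPattern (mv : ∀ i, Measurable (v i)) (D e o : ℕ) :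
    MeasurableSet {ω | SlotPattern D e fun j => v (o + j) ω} := by
  have : {ω | SlotPattern D e fun j => v (o + j) ω} =
      ⋃ i ∈ Set.Iio D, ({ω | v (o + (D + i)) ω = 1} ∩
        (⋂ j, {ω | i ≤ j → j < D + i → v (o + j) ω = 0}) ∩
        (⋂ j, {ω | D + i < j → j ≤ D + i + e → v (o + j) ω = 0})) := by
    ext ω
    simp only [SlotPattern, Set.mem_ofPred_eq, Set.mem_iUnion, Set.mem_inter_iff, Set.mem_iInter,
      Set.mem_Iio, exists_prop, and_assoc]
  rw [this]
  refine MeasurableSet.biUnion (Set.to_countable _) fun i _ => ?_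
  have h0 : ∀ (p q : Prop) (j : ℕ), MeasurableSet {ω | p → q → v (o + j) ω = 0} := by
    intro p q j
    by_cases hp : p <;> by_cases hq : q <;> simp only [hp, hq, true_imp_iff, false_imp_iff]
    · exact measurableSet_eq_fun (mv _) measurable_const
    all_goals exact MeasurableSet.univ
  exact ((measurableSet_eq_fun (mv _) measurable_const).inter
    (MeasurableSet.iInter fun j => h0 _ _ j)).inter (MeasurableSet.iInter fun j => h0 _ _ j)

/-- The count reads only slots before `o + 3 * D * K`, the indicator only the next `3 * D` slots. -/
lemma indepFun_patternCount (mv : ∀ i, Measurable (v i)) (hv : iIndepFun v P) {D e : ℕ}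
    (he : e ≤ D) (o K : ℕ) :
    IndepFun (fun ω => (patternCount v D e o K ω : ℝ))
      (Set.indicator {ω | SlotPattern D e fun j => v (o + 3 * D * K + j) ω} fun _ => (1 : ℝ)) P := by
  classical
  set S := Finset.range (o + 3 * D * K) with hS
  set S' := Finset.Ico (o + 3 * D * K) (o + 3 * D * K + 3 * D) with hS'
  have hdisj : Disjoint S S' := by
    rw [Finset.disjoint_left]
    intro i h h'
    simp only [hS, hS', Finset.mem_range, Finset.mem_Ico] at h h'
    omega
  have key := hv.indepFun_finset S S' hdisj mv
  -- Restricted slot vectors are padded by zeros; `SlotPattern.congr` shows that the padding is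
  -- never read.
  let ext : (A : Finset ℕ) → (A → ℕ) → ℕ → ℕ := fun A x i => if h : i ∈ A then x ⟨i, h⟩ else 0
  have hext : ∀ (A : Finset ℕ) ω i, i ∈ A → ext A (fun i => v i ω) i = v i ω := fun A ω i hi =>
    dif_pos hi
  have := key.comp
    (φ := fun x => (patternCount (fun i (_ : Unit) => ext S x i) D e o K () : ℝ))
    (ψ := fun x => if SlotPattern D e fun j => ext S' x (o + 3 * D * K + j) then (1 : ℝ) else 0)
    Measurable.of_discrete Measurable.of_discrete
  convert this using 1
  · ext ω
    simp only [Function.comp, patternCount]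
    congr 2
    refine Finset.filter_congr fun b hb => SlotPattern.congr he fun j hj => ?_
    rw [hext]
    have hb := Finset.mem_range.1 hb
    have : 3 * D * (b + 1) ≤ 3 * D * K := Nat.mul_le_mul_left _ hb
    simp only [hS, Finset.mem_range]
    rw [mul_add] at this
    omega
  · ext ω
    simp only [Function.comp, Set.indicator, Set.mem_ofPred_eq]
    refine if_congr (SlotPattern.congr he fun j hj => ?_) rfl rfl
    rw [hext]
    simp only [hS', Finset.mem_Ico]
    omega

variable [IsProbabilityMeasure P]

/-- For a fixed start, independence multiplies the probabilities of one slot with value 1 and `D +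
e` empty slots. Starts `i < i' < D` exclude each other: slot `D + i` is occupied for the first and
belongs to the initial empty run of the second. So the probability is exactly a sum of `D` equal
terms. -/
lemma prob_slotPattern (mv : ∀ i, Measurable (v i)) (hv : iIndepFun v P)
    (law : ∀ i, HasLaw (v i) (poissonMeasure ρ) P) (D e o : ℕ) :
    P.real {ω | SlotPattern D e fun j => v (o + j) ω} =
      D * (ρ * Real.exp (-ρ)) * Real.exp (-(ρ * (D + e))) := by
  classical
  have hprob : ∀ i a : ℕ, P.real (v i ⁻¹' {a}) = Real.exp (-ρ) * (ρ : ℝ) ^ a / a.factorial := by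
    intro i a
    rw [← poissonMeasure_real_singleton, ← (law i).map_eq,
      map_measureReal_apply (mv i) (measurableSet_singleton a)]
  let J : ℕ → Finset ℕ := fun i => Finset.Ico i (D + i) ∪ Finset.Ioc (D + i) (D + i + e)
  have hJ : ∀ i, (D + i) ∉ J i := by
    intro i h
    simp only [J, Finset.mem_union, Finset.mem_Ico, Finset.mem_Ioc] at h
    omega
  have hJc : ∀ i, (J i).card = D + e := by
    intro i
    rw [Finset.card_union_of_disjoint, Nat.card_Ico, Nat.card_Ioc]
    · omega
    · rw [Finset.disjoint_left]
      intro j h1 h2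
      simp only [Finset.mem_Ico, Finset.mem_Ioc] at h1 h2
      omega
  let B : ℕ → Set Ω := fun i => ⋂ j ∈ insert (D + i) (J i),
    (v (o + j)) ⁻¹' (if j = D + i then {1} else {0})
  have mB : ∀ i, MeasurableSet (B i) := fun i =>
    Finset.measurableSet_biInter _ fun j _ => mv _ (by split_ifs <;> exact measurableSet_singleton _)
  have hB : ∀ i ω, ω ∈ B i ↔ v (o + (D + i)) ω = 1 ∧ ∀ j ∈ J i, v (o + j) ω = 0 := by
    intro i ω
    simp only [B, Set.mem_iInter, Finset.mem_insert, Set.mem_preimage]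
    constructor
    · intro h
      refine ⟨by simpa using h (D + i) (Or.inl rfl), fun j hj => ?_⟩
      have hne : j ≠ D + i := fun h' => hJ i (h' ▸ hj)
      simpa [hne] using h j (Or.inr hj)
    · rintro ⟨h1, h2⟩ j (rfl | hj)
      · simpa using h1
      · have hne : j ≠ D + i := fun h' => hJ i (h' ▸ hj)
        simpa [hne] using h2 j hj
  have hset : {ω | SlotPattern D e fun j => v (o + j) ω} = ⋃ i ∈ Finset.range D, B i := by
    ext ω
    simp only [SlotPattern, Set.mem_ofPred_eq, Set.mem_iUnion, Finset.mem_range, exists_prop, hB,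
      J, Finset.mem_union, Finset.mem_Ico, Finset.mem_Ioc]
    refine exists_congr fun i => and_congr_right fun _ => and_congr_right fun _ => ?_
    constructor
    · rintro ⟨h1, h2⟩ j (h | h)
      exacts [h1 j h.1 h.2, h2 j h.1 h.2]
    · intro h
      exact ⟨fun j h1 h2 => h j (Or.inl ⟨h1, h2⟩), fun j h1 h2 => h j (Or.inr ⟨h1, h2⟩)⟩
  have hdisj : Set.PairwiseDisjoint (↑(Finset.range D)) B := by
    have aux : ∀ i i', i < i' → i' < D → Disjoint (B i) (B i') := by
      intro i i' hii hi'
      rw [Set.disjoint_left]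
      intro ω h h'
      have h1 := ((hB i ω).1 h).1
      have h2 := ((hB i' ω).1 h').2 (D + i) (by
        simp only [J, Finset.mem_union, Finset.mem_Ico]
        omega)
      omega
    intro i hi i' hi' hne
    have hi := Finset.mem_range.1 (Finset.mem_coe.1 hi)
    have hi' := Finset.mem_range.1 (Finset.mem_coe.1 hi')
    rcases lt_or_gt_of_ne hne with h | h
    exacts [aux i i' h hi', (aux i' i h hi).symm]
  have hPB : ∀ i, P.real (B i) = ρ * Real.exp (-ρ) * Real.exp (-(ρ * (D + e))) := by
    intro i
    have hind : iIndepFun (fun j => v (o + j)) P := hv.precomp (add_right_injective o)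
    have h1 := hind.measure_inter_preimage_eq_mul (insert (D + i) (J i))
      (sets := fun j => if j = D + i then {1} else {0})
      (fun j _ => by split_ifs <;> exact measurableSet_singleton _)
    have h2 : P.real (B i) = ∏ j ∈ insert (D + i) (J i),
        P.real (v (o + j) ⁻¹' (if j = D + i then {1} else {0})) := by
      simp only [measureReal_def]
      rw [← ENNReal.toReal_prod, ← h1]
    rw [h2, Finset.prod_insert (hJ i), if_pos rfl, hprob]
    have h3 : ∀ j ∈ J i, P.real (v (o + j) ⁻¹' (if j = D + i then {1} else {0})) =
        Real.exp (-ρ) := by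
      intro j hj
      have hne : j ≠ D + i := fun h' => hJ i (h' ▸ hj)
      rw [if_neg hne, hprob]
      simp
    rw [Finset.prod_congr rfl h3, Finset.prod_const, hJc, ← Real.exp_nat_mul]
    push_cast
    have : ((D : ℝ) + e) * -(ρ : ℝ) = -(ρ * (D + e)) := by ring
    rw [this, pow_one, Nat.factorial_one, Nat.cast_one, div_one, mul_comm (Real.exp (-(ρ : ℝ)))]
  rw [hset, measureReal_biUnion_finset hdisj fun i _ => mB i, Finset.sum_congr rfl fun i _ => hPB i,
    Finset.sum_const, Finset.card_range, nsmul_eq_mul, mul_assoc (D : ℝ)]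

lemma measurable_patternCount (mv : ∀ i, Measurable (v i)) (D e o K : ℕ) :
    Measurable fun ω => (patternCount v D e o K ω : ℝ) := by
  induction K with
  | zero => simp [patternCount]
  | succ K ih =>
    simp_rw [patternCount_succ]
    exact ih.add (measurable_const.indicator (measurableSet_slotPattern mv D e _))

/-- The left side equals 1 - P(A) (1 - exp(-θ)), and 1 - x ≤ exp(-x). This compares the indicator
with a Poisson variable of the same mean. -/
lemma mgf_indicator_le {A : Set Ω} (hA : MeasurableSet A) (θ : ℝ) :
    mgf (A.indicator fun _ => (1 : ℝ)) P (-θ) ≤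
      Real.exp (-(P.real A * (1 - Real.exp (-θ)))) := by
  have h1 : ∀ ω, Real.exp (-θ * A.indicator (fun _ => (1 : ℝ)) ω) =
      1 - A.indicator (fun _ => 1 - Real.exp (-θ)) ω := by
    intro ω
    by_cases h : ω ∈ A <;> simp [h]
  unfold mgf
  simp_rw [h1]
  rw [integral_sub (integrable_const _) ((integrable_const _).indicator hA),
    integral_indicator_const _ hA]
  simp only [integral_const, probReal_univ, smul_eq_mul, mul_one]
  have := Real.add_one_le_exp (-(P.real A * (1 - Real.exp (-θ))))
  linarith

lemma mgf_patternCount_le (mv : ∀ i, Measurable (v i)) (hv : iIndepFun v P)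
    (law : ∀ i, HasLaw (v i) (poissonMeasure ρ) P) {D e : ℕ} (he : e ≤ D) (o K : ℕ) (θ : ℝ) :
    mgf (fun ω => (patternCount v D e o K ω : ℝ)) P (-θ) ≤
      Real.exp (-(K * (D * (ρ * Real.exp (-ρ)) * Real.exp (-(ρ * (D + e)))) *
        (1 - Real.exp (-θ)))) := by
  induction K with
  | zero => simp [patternCount, mgf]
  | succ K ih =>
    have hA := measurableSet_slotPattern mv D e (o + 3 * D * K)
    have h1 : (fun ω => (patternCount v D e o (K + 1) ω : ℝ)) =
        (fun ω => (patternCount v D e o K ω : ℝ)) +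
          Set.indicator {ω | SlotPattern D e fun j => v (o + 3 * D * K + j) ω}
            (fun _ => (1 : ℝ)) := by
      ext ω
      exact patternCount_succ v D e o K ω
    rw [h1, (indepFun_patternCount mv hv he o K).mgf_add'
      (measurable_patternCount mv D e o K).aestronglyMeasurable
      (measurable_const.indicator hA).aestronglyMeasurable]
    refine (mul_le_mul ih (mgf_indicator_le hA θ) mgf_nonneg (Real.exp_pos _).le).trans
      (le_of_eq ?_)
    rw [prob_slotPattern mv hv law, ← Real.exp_add]
    push_cast
    ring_nf

lemma patternCount_lower_tail (mv : ∀ i, Measurable (v i)) (hv : iIndepFun v P)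
    (law : ∀ i, HasLaw (v i) (poissonMeasure ρ) P) {D e : ℕ} (he : e ≤ D) (o K : ℕ) {θ : ℝ}
    (hθ : 0 ≤ θ) (y : ℝ) :
    P.real {ω | (patternCount v D e o K ω : ℝ) ≤ y} ≤
      Real.exp (θ * y - K * (D * (ρ * Real.exp (-ρ)) * Real.exp (-(ρ * (D + e)))) *
        (1 - Real.exp (-θ))) := by
  have hint : Integrable (fun ω => Real.exp (-θ * (patternCount v D e o K ω : ℝ))) P := by
    refine Integrable.of_bound (C := 1) ?_ ?_
    · exact ((measurable_patternCount mv D e o K).const_mul _).exp.aestronglyMeasurable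
    · refine Filter.Eventually.of_forall fun ω => ?_
      rw [Real.norm_eq_abs, Real.abs_exp, Real.exp_le_one_iff]
      have : (0 : ℝ) ≤ patternCount v D e o K ω := Nat.cast_nonneg _
      nlinarith
  refine (measure_le_le_exp_mul_mgf y (neg_nonpos.2 hθ) hint).trans ?_
  rw [neg_neg, sub_eq_add_neg, Real.exp_add]
  exact mul_le_mul_of_nonneg_left (mgf_patternCount_le mv hv law he o K θ) (Real.exp_pos _).le

end Pattern

/-! ### From slot patterns to laggers and loners -/

lemma not_mined_of_slots_empty {T : ℕ → ℝ} (hT : Filter.Tendsto T Filter.atTop Filter.atTop)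
    {H : ℕ → Prop} {τ : ℕ → ℝ} (hτ : Monotone τ) {a c : ℕ}
    (h : ∀ j, a ≤ j → j < c → minedCount T H (τ j) (τ (j + 1)) = 0) {k : ℕ} (hk : H k)
    (h1 : τ a < T k) : τ c < T k := by
  induction c with
  | zero => exact (hτ (Nat.zero_le a)).trans_lt h1
  | succ c ih =>
    rcases Nat.lt_or_ge c a with hca | hca
    · exact (hτ hca).trans_lt h1
    · have h2 := ih fun j hj hj' => h j hj (by omega)
      by_contra h3
      have h0 := h c hca (Nat.lt_succ_self c)
      rw [minedCount, Set.ncard_eq_zero (finite_setOf_mined hT H _ _)] at h0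
      have hmem : k ∈ {k | H k ∧ τ c < T k ∧ T k ≤ τ (c + 1)} := ⟨hk, h2, not_lt.1 h3⟩
      rw [h0] at hmem
      exact hmem

namespace PrismModel

variable {Ω : Type*} [MeasurableSpace Ω] {P : Measure Ω} {m : ℕ} {α β Δ : ℝ}

lemma measurable_numHonest (M : PrismModel P m α β Δ) (j : Fin (m + 1)) (s t : ℝ) :
    Measurable (M.numHonest j s t) :=
  measurable_minedCount (M.T_tendsto j) (M.measurable_T j) (M.measurable_honest j) s t

lemma measurable_numAdversarial (M : PrismModel P m α β Δ) (j : Fin (m + 1)) (s t : ℝ) :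
    Measurable (M.numAdversarial j s t) :=
  measurable_minedCount (M.T_tendsto j) (M.measurable_T j)
    (fun k => (M.measurable_honest j k).compl) s t

lemma numHonest_eq_sub (M : PrismModel P m α β Δ) (j : Fin (m + 1)) {s t : ℝ} (hs : 0 ≤ s)
    (hst : s ≤ t) (ω : Ω) :
    M.numHonest j s t ω = minedCount (M.T j ω) (M.honest j ω) 0 t -
      minedCount (M.T j ω) (M.honest j ω) 0 s := by
  have := minedCount_add (M.T_tendsto j ω) (M.honest j ω) hs hst
  unfold numHonest
  omega

lemma hasLaw_numHonest (M : PrismModel P m α β Δ) (j : Fin (m + 1)) {s t : ℝ} (hs : 0 ≤ s)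
    (hst : s < t) :
    HasLaw (M.numHonest j s t) (poissonMeasure (Real.toNNReal (α * (t - s)))) P := by
  have h := (M.honest_poisson j).law ⟨s, hs⟩ ⟨t, hs.trans hst.le⟩ hst
  have h2 : M.numHonest j s t = fun ω => minedCount (M.T j ω) (M.honest j ω) 0 t -
      minedCount (M.T j ω) (M.honest j ω) 0 s := by
    ext ω
    exact M.numHonest_eq_sub j hs hst.le ω
  rw [h2]
  exact h

/-- The number of honest blocks in the `i`-th slot of length `ε` after time `s`. -/
noncomputable def slotCount (M : PrismModel P m α β Δ) (j : Fin (m + 1)) (s ε : ℝ) (i : ℕ) (ω : Ω) : ℕ :=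
  M.numHonest j (s + i * ε) (s + ((i + 1 : ℕ) : ℝ) * ε) ω

lemma measurable_slotCount (M : PrismModel P m α β Δ) (j : Fin (m + 1)) (s ε : ℝ) (i : ℕ) :
    Measurable (M.slotCount j s ε i) := M.measurable_numHonest j _ _

lemma hasLaw_slotCount (M : PrismModel P m α β Δ) (j : Fin (m + 1)) {s ε : ℝ} (hs : 0 ≤ s)
    (hε : 0 < ε) (i : ℕ) :
    HasLaw (M.slotCount j s ε i) (poissonMeasure (Real.toNNReal (α * ε))) P := by
  have h := M.hasLaw_numHonest j (s := s + i * ε) (t := s + ((i + 1 : ℕ) : ℝ) * ε)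
    (by positivity) (by push_cast; linarith)
  have h2 : s + ((i + 1 : ℕ) : ℝ) * ε - (s + i * ε) = ε := by
    push_cast
    ring
  rwa [h2] at h

lemma iIndepFun_slotCount (M : PrismModel P m α β Δ) (j : Fin (m + 1)) {s ε : ℝ} (hs : 0 ≤ s)
    (hε : 0 < ε) : iIndepFun (M.slotCount j s ε) P := by
  have hmono : Monotone fun i : ℕ => (⟨s + i * ε, by positivity⟩ : ℝ≥0) := by
    intro a b hab
    have : (a : ℝ) ≤ b := by exact_mod_cast hab
    change s + a * ε ≤ s + b * ε
    nlinarith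
  have h := (M.honest_poisson j).indep.nat hmono
  convert h using 2 with i
  ext ω
  refine M.numHonest_eq_sub j (by positivity) ?_ ω
  push_cast
  linarith

/-- The slot pattern produces a lagger, and even a loner when its final part is long enough. -/
lemma exists_lagger_of_slotPattern (M : PrismModel P m α β Δ) (j : Fin (m + 1)) {s ε : ℝ}
    (hs : 0 ≤ s) (hε : 0 < ε) {D e o : ℕ} (hD : D * ε = Δ) {ω : Ω}
    (h : SlotPattern D e fun i => M.slotCount j s ε (o + i) ω) :
    ∃ k, M.IsLagger j ω k ∧ (D ≤ e → M.IsLoner j ω k) ∧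
      s + o * ε + Δ < M.T j ω k ∧ M.T j ω k ≤ s + o * ε + 2 * Δ := by
  obtain ⟨i, hi, hone, hpre, hpost⟩ := h
  set τ : ℕ → ℝ := fun i => s + i * ε with hτ
  have hτm : Monotone τ := by
    intro a b hab
    have : (a : ℝ) ≤ b := by exact_mod_cast hab
    simp only [hτ]
    nlinarith
  have hadd : ∀ a, τ (a + D) = τ a + Δ := by
    intro a
    simp only [hτ]
    push_cast
    rw [← hD]
    ring
  have hT := M.T_tendsto j ω
  obtain ⟨k, hk⟩ := Set.ncard_eq_one.1 hone
  obtain ⟨hkh, hk1, hk2⟩ : M.honest j ω k ∧ τ (o + (D + i)) < M.T j ω k ∧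
      M.T j ω k ≤ τ (o + (D + i) + 1) := by
    have : k ∈ ({k} : Set ℕ) := rfl
    rw [← hk] at this
    exact this
  have huniq : ∀ x, M.honest j ω x → τ (o + (D + i)) < M.T j ω x →
      M.T j ω x ≤ τ (o + (D + i) + 1) → x = k := by
    intro x h1 h2 h3
    have : x ∈ ({k} : Set ℕ) := hk ▸ ⟨h1, h2, h3⟩
    exact this
  have hlag : M.IsLagger j ω k := by
    refine ⟨?_, hkh, fun x hx h1 h2 => ?_⟩
    -- Slots begin no earlier than `s ≥ 0` and exclude their left end, so genesis lies in none of
    -- them.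
    · rcases Nat.eq_zero_or_pos k with rfl | h
      · rw [M.T_genesis] at hk1
        have : 0 ≤ τ (o + (D + i)) := by positivity
        linarith
      · exact h
    · refine huniq x hx ?_ (h2.trans hk2)
      have h3 : τ (o + i) < M.T j ω x := by
        have := hadd (o + i)
        have h4 : o + i + D = o + (D + i) := by ring
        rw [h4] at this
        linarith
      refine not_mined_of_slots_empty hT hτm (a := o + i) (fun y hy hy' => ?_) hx h3
      have := hpre (y - o) (by omega) (by omega)
      simp only at this
      rwa [Nat.add_sub_cancel' (by omega)] at this
  refine ⟨k, hlag, fun hDe => ⟨hlag, fun x hx h1 h2 => ?_⟩, ?_, ?_⟩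
  · refine huniq x hx (hk1.trans_le h1) ?_
    by_contra h3
    have h4 := not_mined_of_slots_empty hT hτm (a := o + (D + i) + 1)
      (c := o + (D + i) + 1 + D) (fun y hy hy' => by
        have := hpost (y - o) (by omega) (by omega)
        simp only at this
        rwa [Nat.add_sub_cancel' (by omega)] at this) hx (not_le.1 h3)
    rw [hadd] at h4
    linarith
  · have h1 := hadd o
    have h2 := hτm (show o + D ≤ o + (D + i) by omega)
    have h3 : τ o = s + o * ε := rfl
    linarith
  · have h1 := hadd o
    have h1' := hadd (o + D)
    have h2 := hτm (show o + (D + i) + 1 ≤ o + D + D by omega)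
    have h3 : τ o = s + o * ε := rfl
    linarith

/-- The pattern in block `b` of phase `r` places its lagger in the middle third `(s + (r + 3b + 1)Δ,
s + (r + 3b + 2)Δ]`. For `r < 3` the number `r + 3b` determines `r` and `b`, so these intervals are
disjoint and no lagger is counted twice. -/
lemma sum_patternCount_le (M : PrismModel P m α β Δ) (hΔ : 0 < Δ) (j : Fin (m + 1)) {s ε : ℝ}
    (hs : 0 ≤ s) (hε : 0 < ε) {D e K : ℕ} (hD : D * ε = Δ) {u : ℝ} (hu : s + (3 * K + 2) * Δ ≤ u)
    (ω : Ω) {H : ℕ → Prop} (hH : ∀ k, M.IsLagger j ω k → (D ≤ e → M.IsLoner j ω k) → H k) :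
    ∑ r ∈ Finset.range 3, patternCount (M.slotCount j s ε) D e (r * D) K ω ≤
      minedCount (M.T j ω) H s u := by
  classical
  unfold patternCount
  rw [← Finset.card_sigma]
  have hex : ∀ p : (_ : ℕ) × ℕ, ∃ k, (SlotPattern D e fun i =>
      M.slotCount j s ε (p.1 * D + 3 * D * p.2 + i) ω) → H k ∧
        s + (p.1 + 3 * p.2 + 1) * Δ < M.T j ω k ∧ M.T j ω k ≤ s + (p.1 + 3 * p.2 + 2) * Δ := by
    intro p
    by_cases hp : SlotPattern D e fun i => M.slotCount j s ε (p.1 * D + 3 * D * p.2 + i) ω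
    · obtain ⟨k, h1, h2, h3, h4⟩ := M.exists_lagger_of_slotPattern j hs hε hD hp
      have h5 : ((p.1 * D + 3 * D * p.2 : ℕ) : ℝ) * ε = (p.1 + 3 * p.2) * Δ := by
        rw [← hD]
        push_cast
        ring
      rw [h5] at h3 h4
      exact ⟨k, fun _ => ⟨hH k h1 h2, by linarith, by linarith⟩⟩
    · exact ⟨0, fun h => absurd h hp⟩
  choose f hf using hex
  refine card_le_minedCount (M.T_tendsto j ω) _ f ?_ ?_
  · have aux : ∀ p q : (_ : ℕ) × ℕ, p.1 + 3 * p.2 < q.1 + 3 * q.2 →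
        s + ((p.1 : ℝ) + 3 * p.2 + 2) * Δ ≤ s + ((q.1 : ℝ) + 3 * q.2 + 1) * Δ := by
      intro p q h
      have : ((p.1 : ℝ) + 3 * p.2) + 1 ≤ q.1 + 3 * q.2 := by exact_mod_cast h
      nlinarith
    intro p hp q hq hpq
    simp only [Finset.coe_sigma, Set.mem_sigma_iff, Finset.mem_coe, Finset.mem_range,
      Finset.mem_filter] at hp hq
    have h1 := hf p hp.2.2
    have h2 := hf q hq.2.2
    rw [hpq] at h1
    have h3 : p.1 + 3 * p.2 = q.1 + 3 * q.2 := by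
      rcases lt_trichotomy (p.1 + 3 * p.2) (q.1 + 3 * q.2) with h | h | h
      · have := aux p q h
        linarith [h1.2.2, h2.2.1]
      · exact h
      · have := aux q p h
        linarith [h2.2.2, h1.2.1]
    have h4 := hp.1
    have h5 := hq.1
    rcases p with ⟨p1, p2⟩
    rcases q with ⟨q1, q2⟩
    simp only at h3 h4 h5
    obtain ⟨rfl, rfl⟩ : p1 = q1 ∧ p2 = q2 := by omega
    rfl
  · intro p hp
    simp only [Finset.mem_sigma, Finset.mem_range, Finset.mem_filter] at hp
    obtain ⟨h1, h2, h3⟩ := hf p hp.2.2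
    refine ⟨h1, ?_, ?_⟩
    · have : 0 ≤ ((p.1 : ℝ) + 3 * p.2 + 1) * Δ := by positivity
      linarith
    · have h4 : p.1 + 3 * p.2 ≤ 3 * K := by omega
      have h5 : (p.1 : ℝ) + 3 * p.2 ≤ 3 * K := by exact_mod_cast h4
      nlinarith

end PrismModel

/-! ### Exponential rates of the tail bounds -/

/-- A second-order bound for the exponential function. -/
lemma exp_le_one_add_add_sq {x : ℝ} (hx : |x| ≤ 1) : Real.exp x ≤ 1 + x + x ^ 2 := by
  have := (abs_le.1 (Real.abs_exp_sub_one_sub_id_le hx)).2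
  linarith

/-- `W` is the covered time, `E` the probability that a slot is empty and `B` the factor from the
moment generating function at `-δ / 2`. First-order terms in `δ` cancel; second-order terms leave
-δ²/2 + δ²/4. Losses of relative size 2δ/79, 5δ/79 and δ/79 still leave -δ²/9. -/
lemma pattern_exponent_le {δ ℓ Δ W E B : ℝ} (hδ : 0 < δ) (hδ' : δ < 40 / 81)
    (hℓ : 79 * (1 + Δ) ≤ δ * ℓ) (hΔ : 0 < Δ) (hW0 : 0 ≤ W) (hW : ℓ - 5 * Δ ≤ W)
    (hE : 1 - δ / 79 ≤ E) (hB : δ / 2 - (δ / 2) ^ 2 ≤ B) :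
    δ / 2 * ((1 - δ) * (ℓ + 2)) - W * E * B ≤ -(1 / 9 * δ ^ 2 * ℓ) := by
  have hℓ0 : 0 < ℓ := by
    by_contra h
    nlinarith
  have h1 : ℓ * (1 - 6 * δ / 79) ≤ W * E := by
    have h2 : ℓ * (1 - 5 * δ / 79) ≤ W := by linarith
    have h3 : ℓ * (1 - 5 * δ / 79) * (1 - δ / 79) ≤ W * E :=
      mul_le_mul h2 hE (by linarith) hW0
    nlinarith [mul_pos hℓ0 (mul_pos hδ hδ)]
  have h4 : ℓ * (1 - 6 * δ / 79) * (δ / 2 - (δ / 2) ^ 2) ≤ W * E * B :=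
    mul_le_mul h1 hB (by nlinarith) (mul_nonneg hW0 (by linarith))
  have h5 : δ / 2 * ((1 - δ) * (ℓ + 2)) ≤ δ / 2 * (ℓ * (1 - δ + 2 * δ / 79)) :=
    mul_le_mul_of_nonneg_left (by nlinarith) (by positivity)
  have h6 : δ / 2 * (ℓ * (1 - δ + 2 * δ / 79)) -
      ℓ * (1 - 6 * δ / 79) * (δ / 2 - (δ / 2) ^ 2) =
      ℓ * δ ^ 2 * (-(71 / 158) + 1 / 4 - 6 * δ / 316) := by ring
  have h7 : 0 < ℓ * δ ^ 2 := by positivity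
  nlinarith

namespace PrismModel

variable {Ω : Type*} [MeasurableSpace Ω] {P : Measure Ω} [IsProbabilityMeasure P] {m : ℕ}
  {α β Δ δ : ℝ}

/-- Lower tail of the number of blocks with a property that is implied by the slot pattern. -/
lemma pattern_lower_tail (M : PrismModel P m α β Δ) (hα : 0 < α) (hΔ : 0 < Δ) (hδ : 0 < δ)
    (hδ' : δ < 40 / 81) (j : Fin (m + 1)) {s ℓ : ℝ} (hs : 0 ≤ s) (hℓ : 79 * (1 + Δ) ≤ δ * ℓ)
    (c : ℕ) (hc : c ≤ 1) (H : Ω → ℕ → Prop)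
    (hH : ∀ ω k, M.IsLagger j ω k → (1 ≤ c → M.IsLoner j ω k) → H ω k) :
    P.real {ω | (minedCount (M.T j ω) (H ω) s (s + ℓ) : ℝ) ≤
        (1 - δ) * (ℓ + 2) * M.g ^ (1 + c) * α} ≤
      3 * Real.exp (-(1 / 9 * δ ^ 2 * (M.g ^ (1 + c) * α / 3) * ℓ)) := by
  -- Slots are short enough that the mean count `α * ε` is at most `δ / 79`.
  obtain ⟨D, hD⟩ := exists_nat_gt (79 * α * Δ / δ)
  have hD0 : (0 : ℝ) < D := lt_of_le_of_lt (by positivity) hD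
  have hD1 : 1 ≤ D := by exact_mod_cast hD0
  set ε := Δ / D with hε
  have hε0 : 0 < ε := div_pos hΔ hD0
  have hDε : D * ε = Δ := mul_div_cancel₀ _ hD0.ne'
  have hαε : α * ε ≤ δ / 79 := by
    rw [div_lt_iff₀ hδ] at hD
    rw [le_div_iff₀ (by norm_num : (0 : ℝ) < 79)]
    have : D * (α * ε * 79) ≤ D * δ := by
      have : D * (α * ε * 79) = 79 * α * (D * ε) := by ring
      rw [this, hDε]
      exact hD.le
    exact le_of_mul_le_mul_left this hD0
  have hℓ0 : 0 < ℓ := by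
    by_contra h
    nlinarith
  -- The largest number of blocks of length `3 * Δ` for which the phases shifted by 0, `Δ` and `2 *
  -- Δ` all fit into `ℓ`.
  set K := ⌊(ℓ / Δ - 2) / 3⌋₊ with hK
  have hbig : 79 ≤ ℓ / Δ := by
    rw [le_div_iff₀ hΔ]
    nlinarith
  have hK1 : (3 * K + 2) * Δ ≤ ℓ := by
    have h := Nat.floor_le (show 0 ≤ (ℓ / Δ - 2) / 3 by linarith)
    rw [← hK] at h
    rw [← le_div_iff₀ hΔ]
    linarith
  have hK2 : ℓ - 5 * Δ ≤ 3 * K * Δ := by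
    have h := Nat.lt_floor_add_one ((ℓ / Δ - 2) / 3)
    rw [← hK] at h
    have h2 : ℓ / Δ ≤ 3 * K + 5 := by linarith
    rw [div_le_iff₀ hΔ] at h2
    linarith
  set γ := M.g ^ (1 + c) with hγ
  have hγ0 : 0 < γ := pow_pos M.g_pos _
  have he : c * D ≤ D := by nlinarith
  set x := (1 - δ) * (ℓ + 2) * γ * α with hx
  set θ := δ / 2 with hθ
  -- some phase has few blocks that contain the pattern
  have hsub : {ω | (minedCount (M.T j ω) (H ω) s (s + ℓ) : ℝ) ≤ x} ⊆
      ⋃ r ∈ Finset.range 3,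
        {ω | (patternCount (M.slotCount j s ε) D (c * D) (r * D) K ω : ℝ) ≤ x / 3} := by
    intro ω hω
    have h1 := M.sum_patternCount_le hΔ j hs hε0 (e := c * D) (K := K) hDε
      (u := s + ℓ) (by linarith) ω
      (H := H ω) fun k h2 h3 => hH ω k h2 fun h4 => h3 (Nat.le_mul_of_pos_left D h4)
    have h2 : (∑ r ∈ Finset.range 3,
        (patternCount (M.slotCount j s ε) D (c * D) (r * D) K ω : ℝ)) ≤ x := by
      refine le_trans ?_ hω
      exact_mod_cast h1
    by_contra h3
    simp only [Set.mem_iUnion, Set.mem_ofPred_eq, exists_prop, not_exists, not_and, not_le] at h3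
    have h4 : ∑ r ∈ Finset.range 3, x / 3 < ∑ r ∈ Finset.range 3,
        (patternCount (M.slotCount j s ε) D (c * D) (r * D) K ω : ℝ) :=
      Finset.sum_lt_sum_of_nonempty (by simp) h3
    simp only [Finset.sum_const, Finset.card_range, nsmul_eq_mul] at h4
    push_cast at h4
    linarith
  have hρ : ((α * ε).toNNReal : ℝ) = α * ε := Real.coe_toNNReal _ (by positivity)
  have hphase : ∀ r ∈ Finset.range 3,
      P.real {ω | (patternCount (M.slotCount j s ε) D (c * D) (r * D) K ω : ℝ) ≤ x / 3} ≤
        Real.exp (-(1 / 9 * δ ^ 2 * (γ * α / 3) * ℓ)) := by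
    intro r _
    refine (patternCount_lower_tail (M.measurable_slotCount j s ε) (M.iIndepFun_slotCount j hs hε0)
      (M.hasLaw_slotCount j hs hε0) he (r * D) K (θ := θ) (by positivity) (x / 3)).trans ?_
    rw [Real.exp_le_exp, hρ]
    -- Each empty stretch of length `Δ` contributes one factor `g`: one stretch for laggers (`c =
    -- 0`), two for loners (`c = 1`).
    have h1 : Real.exp (-(α * ε * (D + (c * D : ℕ)))) = γ := by
      rw [hγ, g, ← Real.exp_nat_mul, ← hDε]
      congr 1
      push_cast
      ring
    rw [h1]
    have h2 : (D : ℝ) * (α * ε * Real.exp (-(α * ε))) * γ =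
        Δ * (α * γ) * Real.exp (-(α * ε)) := by
      rw [← hDε]
      ring
    rw [h2]
    have h3 : 1 - δ / 79 ≤ Real.exp (-(α * ε)) := by
      have := Real.add_one_le_exp (-(α * ε))
      linarith
    have h4 : θ - θ ^ 2 ≤ 1 - Real.exp (-θ) := by
      have := exp_le_one_add_add_sq (x := -θ) (by rw [abs_neg, abs_of_pos (by positivity)]; linarith)
      rw [neg_sq] at this
      linarith
    set A := α * γ / 3 with hA
    have hA0 : 0 < A := by positivity
    have h10 := pattern_exponent_le hδ hδ' hℓ hΔ (by positivity) hK2 h3 h4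
    have h14 : θ * (x / 3) - K * (Δ * (α * γ) * Real.exp (-(α * ε))) * (1 - Real.exp (-θ)) =
        A * (θ * ((1 - δ) * (ℓ + 2)) -
          (3 * K * Δ) * Real.exp (-(α * ε)) * (1 - Real.exp (-θ))) := by
      rw [hx, hA]
      ring
    have h15 : -(1 / 9 * δ ^ 2 * (γ * α / 3) * ℓ) = A * -(1 / 9 * δ ^ 2 * ℓ) := by
      rw [hA]
      ring
    rw [h14, h15]
    exact mul_le_mul_of_nonneg_left h10 hA0.le
  refine (measureReal_mono hsub (measure_ne_top _ _)).trans ((measureReal_biUnion_finset_le _ _).trans ?_)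
  refine (Finset.sum_le_sum hphase).trans (le_of_eq ?_)
  simp

end PrismModel

/-- Chernoff at `δ / 2` for mean `b * (ℓ + 2)`. The excess is scaled by `c` rather than `b`, as the
adversarial rate may be far below `g² α`; `b ≤ c` lets it dominate the second-order term. -/
lemma poisson_upper_exponent_le {δ ℓ b c : ℝ} (hδ : 0 < δ) (hδ' : δ < 40 / 81)
    (hℓ : 79 ≤ δ * ℓ) (hb : 0 ≤ b) (hbc : b ≤ c) :
    -(δ / 2) * (ℓ * b + ℓ * c * δ) + b * (ℓ + 2) * (Real.exp (δ / 2) - 1) ≤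
      -(1 / 27 * (δ ^ 2 * c) * ℓ) := by
  have hℓ0 : 0 < ℓ := by
    by_contra h
    nlinarith
  have hexp := exp_le_one_add_add_sq (x := δ / 2) (by rw [abs_of_pos (by positivity)]; linarith)
  have h1 : b * (ℓ + 2) * (Real.exp (δ / 2) - 1) ≤
      b * (ℓ * (1 + 2 * δ / 79)) * (δ / 2 + (δ / 2) ^ 2) := by
    apply mul_le_mul
    · exact mul_le_mul_of_nonneg_left (by linarith) hb
    · linarith
    · have := Real.add_one_le_exp (δ / 2)
      linarith
    · positivity
  have h2 : b * (ℓ * (1 + 2 * δ / 79)) * (δ / 2 + (δ / 2) ^ 2) - δ / 2 * (ℓ * b) =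
      b * (ℓ * δ ^ 2 * (1 / 4 + 1 / 79 + δ / 158)) := by ring
  have h3 : b * (ℓ * δ ^ 2 * (1 / 4 + 1 / 79 + δ / 158)) ≤
      c * (ℓ * δ ^ 2 * (1 / 4 + 1 / 79 + δ / 158)) :=
    mul_le_mul_of_nonneg_right hbc (by positivity)
  have h4 : 0 ≤ c * (ℓ * δ ^ 2) := mul_nonneg (hb.trans hbc) (by positivity)
  nlinarith

lemma poisson_lower_exponent_le {δ ℓ b : ℝ} (hδ : 0 < δ) (hδ' : δ < 40 / 81)
    (hℓ : 79 ≤ δ * ℓ) (hb : 0 ≤ b) :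
    δ / 2 * ((1 - δ) * (ℓ + 2) * b) + b * ℓ * (Real.exp (-(δ / 2)) - 1) ≤
      -(1 / 27 * (δ ^ 2 * b) * ℓ) := by
  have hℓ0 : 0 < ℓ := by
    by_contra h
    nlinarith
  have hexp := exp_le_one_add_add_sq (x := -(δ / 2))
    (by rw [abs_neg, abs_of_pos (by positivity)]; linarith)
  have h1 : b * ℓ * (Real.exp (-(δ / 2)) - 1) ≤ b * ℓ * (-(δ / 2) + (δ / 2) ^ 2) :=
    mul_le_mul_of_nonneg_left (by linarith) (by positivity)
  have h2 : δ / 2 * ((1 - δ) * (ℓ + 2) * b) ≤ δ / 2 * (ℓ * (1 - δ + 2 * δ / 79) * b) := by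
    apply mul_le_mul_of_nonneg_left _ (by positivity)
    exact mul_le_mul_of_nonneg_right (by nlinarith) hb
  have h3 : 0 ≤ b * (ℓ * δ ^ 2) := by positivity
  have h4 : δ / 2 * (ℓ * (1 - δ + 2 * δ / 79) * b) + b * ℓ * (-(δ / 2) + (δ / 2) ^ 2) =
      b * (ℓ * δ ^ 2) * (-(77 / 158) + 1 / 4) := by ring
  linarith

/-! ### The typical event: rounded intervals and the union bound -/

namespace PrismModel

variable {Ω : Type*} [MeasurableSpace Ω] {P : Measure Ω} {m : ℕ} {α β Δ δ : ℝ}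

/-- The upper bounds of the good event hold on `(u, u + ℓ + 2]`, and the lower bounds hold on
`(s, s + ℓ]`, with room for intervals in between. -/
def roundedGoodEvent (M : PrismModel P m α β Δ) (δ : ℝ) (j : Fin (m + 1)) (s u ℓ : ℝ) : Set Ω :=
  {ω | (M.numHonest j u (u + ℓ + 2) ω : ℝ) < ℓ * α + ℓ * α * δ ∧
    (M.numAdversarial j u (u + ℓ + 2) ω : ℝ) < ℓ * β + ℓ * (M.g ^ 2 * α) * δ ∧
    (1 - δ) * (ℓ + 2) * α < (M.numHonest j s (s + ℓ) ω : ℝ) ∧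
    (1 - δ) * (ℓ + 2) * M.g * α < (M.numLagger j s (s + ℓ) ω : ℝ) ∧
    (1 - δ) * (ℓ + 2) * M.g ^ 2 * α < (M.numLoner j s (s + ℓ) ω : ℝ)}

/-- Of the five ways to fail, the three for honest and adversarial counts cost one exponential each,
laggers and loners three each for the phases. All rates are weakened to that of `g² α ≤ g α ≤ α`. -/
lemma prob_compl_roundedGoodEvent_le [IsProbabilityMeasure P] (M : PrismModel P m α β Δ)
    (hα : 0 < α) (hβ : 0 ≤ β) (hΔ : 0 < Δ) (hδ : 0 < δ) (hδ' : δ < 40 / 81)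
    (hrate : β ≤ M.g ^ 2 * α) (j : Fin (m + 1)) {s u ℓ : ℝ} (hs : 0 ≤ s) (hu : 0 ≤ u)
    (hℓ : 79 * (1 + Δ) ≤ δ * ℓ) :
    P.real (M.roundedGoodEvent δ j s u ℓ)ᶜ ≤ 9 * Real.exp (-(M.eta δ / 27 * ℓ)) := by
  have hg := M.g_pos
  have hg1 := M.g_le_one hα hΔ
  have hℓ0 : 0 < ℓ := by
    by_contra h
    nlinarith
  have hℓ1 : 79 ≤ δ * ℓ := by linarith
  have hθ : 0 ≤ δ / 2 := by positivity
  have hηle : ∀ c, M.g ^ 2 * α ≤ c → -(1 / 27 * (δ ^ 2 * c) * ℓ) ≤ -(M.eta δ / 27 * ℓ) := by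
    intro c hc
    have : δ ^ 2 * ℓ * (M.g ^ 2 * α) ≤ δ ^ 2 * ℓ * c :=
      mul_le_mul_of_nonneg_left hc (by positivity)
    unfold eta
    linarith
  have hgg : M.g ^ 2 ≤ M.g := by nlinarith
  have hgα : M.g ^ 2 * α ≤ α := by nlinarith
  have h1 : P.real {ω | ℓ * α + ℓ * α * δ ≤ (M.numHonest j u (u + ℓ + 2) ω : ℝ)} ≤
      Real.exp (-(M.eta δ / 27 * ℓ)) := by
    have law := M.hasLaw_numHonest j hu (show u < u + ℓ + 2 by linarith)
    have := map_measureReal_apply (μ := P) (M.measurable_numHonest j u (u + ℓ + 2))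
      (s := {n : ℕ | ℓ * α + ℓ * α * δ ≤ n}) (MeasurableSet.of_discrete)
    rw [law.map_eq] at this
    refine (this.symm.le.trans (poisson_upper_tail _ _ hθ)).trans (Real.exp_le_exp.2 ?_)
    rw [Real.coe_toNNReal _ (mul_nonneg hα.le (by linarith))]
    refine le_trans (le_of_eq ?_) ((poisson_upper_exponent_le hδ hδ' hℓ1 hα.le le_rfl).trans
      (hηle α hgα))
    ring
  have h2 : P.real {ω | ℓ * β + ℓ * (M.g ^ 2 * α) * δ ≤
      (M.numAdversarial j u (u + ℓ + 2) ω : ℝ)} ≤ Real.exp (-(M.eta δ / 27 * ℓ)) := by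
    have hr : ((Real.toNNReal (β * (u + ℓ + 2 - u)) : ℝ≥0) : ℝ) = β * (u + ℓ + 2 - u) :=
      Real.coe_toNNReal _ (mul_nonneg hβ (by linarith))
    have := upper_tail_le_poisson (M.measurable_numAdversarial j u (u + ℓ + 2))
      (Real.toNNReal (β * (u + ℓ + 2 - u)))
      (fun a => by
        rw [hr]
        exact M.adversarial_bound j u (u + ℓ + 2) hu (by linarith) a)
      (y := ℓ * β + ℓ * (M.g ^ 2 * α) * δ) (by positivity)
    refine (this.trans (poisson_upper_tail _ _ hθ)).trans (Real.exp_le_exp.2 ?_)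
    rw [hr]
    refine le_trans (le_of_eq ?_) ((poisson_upper_exponent_le hδ hδ' hℓ1 hβ hrate).trans
      (hηle _ le_rfl))
    ring
  have h3 : P.real {ω | (M.numHonest j s (s + ℓ) ω : ℝ) ≤ (1 - δ) * (ℓ + 2) * α} ≤
      Real.exp (-(M.eta δ / 27 * ℓ)) := by
    have law := M.hasLaw_numHonest j hs (show s < s + ℓ by linarith)
    have := map_measureReal_apply (μ := P) (M.measurable_numHonest j s (s + ℓ))
      (s := {n : ℕ | (n : ℝ) ≤ (1 - δ) * (ℓ + 2) * α}) (MeasurableSet.of_discrete)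
    rw [law.map_eq] at this
    refine (this.symm.le.trans (poisson_lower_tail _ _ hθ)).trans (Real.exp_le_exp.2 ?_)
    rw [Real.coe_toNNReal _ (mul_nonneg hα.le (by linarith)), add_sub_cancel_left]
    exact (poisson_lower_exponent_le hδ hδ' hℓ1 hα.le).trans (hηle α hgα)
  have h4 : P.real {ω | (M.numLagger j s (s + ℓ) ω : ℝ) ≤ (1 - δ) * (ℓ + 2) * M.g * α} ≤
      3 * Real.exp (-(M.eta δ / 27 * ℓ)) := by
    have := M.pattern_lower_tail hα hΔ hδ hδ' j hs hℓ 0 (by norm_num) (fun ω => M.IsLagger j ω)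
      fun ω k h _ => h
    rw [add_zero, pow_one] at this
    refine this.trans (mul_le_mul_of_nonneg_left (Real.exp_le_exp.2 ?_) (by norm_num))
    have := hηle (M.g * α) (mul_le_mul_of_nonneg_right hgg hα.le)
    linarith
  have h5 : P.real {ω | (M.numLoner j s (s + ℓ) ω : ℝ) ≤ (1 - δ) * (ℓ + 2) * M.g ^ 2 * α} ≤
      3 * Real.exp (-(M.eta δ / 27 * ℓ)) := by
    have := M.pattern_lower_tail hα hΔ hδ hδ' j hs hℓ 1 le_rfl (fun ω => M.IsLoner j ω)
      fun ω k _ h => h le_rfl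
    refine this.trans (mul_le_mul_of_nonneg_left (Real.exp_le_exp.2 ?_) (by norm_num))
    have := hηle (M.g ^ 2 * α) le_rfl
    norm_num at this ⊢
    linarith
  have hsub : (M.roundedGoodEvent δ j s u ℓ)ᶜ ⊆
      {ω | ℓ * α + ℓ * α * δ ≤ (M.numHonest j u (u + ℓ + 2) ω : ℝ)} ∪
      ({ω | ℓ * β + ℓ * (M.g ^ 2 * α) * δ ≤ (M.numAdversarial j u (u + ℓ + 2) ω : ℝ)} ∪
      ({ω | (M.numHonest j s (s + ℓ) ω : ℝ) ≤ (1 - δ) * (ℓ + 2) * α} ∪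
      ({ω | (M.numLagger j s (s + ℓ) ω : ℝ) ≤ (1 - δ) * (ℓ + 2) * M.g * α} ∪
      {ω | (M.numLoner j s (s + ℓ) ω : ℝ) ≤ (1 - δ) * (ℓ + 2) * M.g ^ 2 * α}))) := by
    intro ω hω
    by_contra h
    simp only [Set.mem_union, Set.mem_ofPred_eq, not_or, not_le] at h
    exact hω h
  have hu1 := measureReal_mono (μ := P) hsub (measure_ne_top _ _)
  refine hu1.trans ((measureReal_union_le _ _).trans ?_)
  refine (add_le_add h1 ((measureReal_union_le _ _).trans (add_le_add h2
    ((measureReal_union_le _ _).trans (add_le_add h3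
      ((measureReal_union_le _ _).trans (add_le_add h4 h5))))))).trans (le_of_eq ?_)
  ring

/-- The typical event can be checked on countably many intervals. -/
lemma compl_typicalEvent_subset (M : PrismModel P m α β Δ) (hα : 0 < α) (hβ : 0 ≤ β)
    (hδ : 0 < δ) (hδ' : δ < 1) (j : Fin (m + 1)) (s t : ℝ) :
    (M.typicalEvent δ j s t)ᶜ ⊆ ⋃ (p : ℕ) (q : ℕ) (_ : (p : ℝ) ≤ s),
      (M.roundedGoodEvent δ j (s - p) (max 0 (s - p - 1)) (t - s + p + q))ᶜ := by
  intro ω hω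
  by_contra hcon
  simp only [Set.mem_iUnion, Set.mem_compl_iff, not_exists, not_not] at hcon
  apply hω
  simp only [typicalEvent, Set.mem_iInter]
  rintro a ⟨ha, has⟩ b (hb : t ≤ b)
  have hp1 := Nat.floor_le (sub_nonneg.2 has)
  have hp2 := Nat.lt_floor_add_one (s - a)
  have hq1 := Nat.floor_le (sub_nonneg.2 hb)
  have hq2 := Nat.lt_floor_add_one (b - t)
  -- The interval `(a, b]` contains `(s - p, t + q]` and lies in `(s - p - 1, t + q + 1]`, which is
  -- longer by 2. Cutting the outer left end at 0 keeps it a legitimate time and loses nothing, as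
  -- `0 ≤ a`.
  set p := ⌊s - a⌋₊
  set q := ⌊b - t⌋₊
  obtain ⟨h1, h2, h3, h4, h5⟩ := hcon p q (by linarith)
  have hT := M.T_tendsto j ω
  set ℓ := t - s + p + q with hℓ
  set u := max 0 (s - p - 1) with hu
  have hua : u ≤ a := max_le ha (by linarith)
  have hbu : b ≤ u + ℓ + 2 := by
    have : s - p - 1 ≤ u := le_max_right _ _
    linarith
  have has' : a ≤ s - p := by linarith
  have hsb : s - p + ℓ ≤ b := by linarith
  have hl1 : ℓ ≤ b - a := by linarith
  have hl2 : b - a ≤ ℓ + 2 := by linarith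
  have hg := M.g_pos
  have hout : ∀ H : ℕ → Prop, (minedCount (M.T j ω) H a b : ℝ) ≤
      minedCount (M.T j ω) H u (u + ℓ + 2) := fun H => by
    exact_mod_cast minedCount_mono hT H hua hbu
  have hin : ∀ H : ℕ → Prop, (minedCount (M.T j ω) H (s - p) (s - p + ℓ) : ℝ) ≤
      minedCount (M.T j ω) H a b := fun H => by
    exact_mod_cast minedCount_mono hT H has' hsb
  have hlow : ∀ c : ℝ, 0 ≤ c → (1 - δ) * (b - a) * c ≤ (1 - δ) * (ℓ + 2) * c := fun c hc =>
    mul_le_mul_of_nonneg_right (mul_le_mul_of_nonneg_left hl2 (by linarith)) hc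
  have hup : ∀ c : ℝ, 0 ≤ c → ℓ * c ≤ (b - a) * c := fun c hc =>
    mul_le_mul_of_nonneg_right hl1 hc
  refine ⟨⟨?_, ?_⟩, ?_, ?_, ?_⟩
  · exact (hlow α hα.le).trans_lt (h3.trans_le (hin _))
  · refine (hout _).trans_lt (h1.trans_le ?_)
    have := hup (α + α * δ) (by positivity)
    linarith
  · have := hlow (M.g * α) (by positivity)
    rw [← mul_assoc, ← mul_assoc] at this
    exact this.trans_lt (h4.trans_le (hin _))
  · have := hlow (M.g ^ 2 * α) (by positivity)
    rw [← mul_assoc, ← mul_assoc] at this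
    exact this.trans_lt (h5.trans_le (hin _))
  · refine (hout _).trans_lt (h2.trans_le ?_)
    have := hup (β + M.g ^ 2 * α * δ) (by positivity)
    linarith

/-- The typical event fails with a probability that is exponentially small in the length of the
interval. -/
theorem prob_compl_typicalEvent_le [IsProbabilityMeasure P] (M : PrismModel P m α β Δ)
    (hα : 0 < α) (hβ : 0 ≤ β) (hΔ : 0 < Δ) (hδ : 0 < δ) (hδ' : δ < 40 / 81)
    (hrate : β ≤ M.g ^ 2 * α) (j : Fin (m + 1)) {s t : ℝ} (hst : 79 * (1 + Δ) ≤ δ * (t - s)) :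
    P (M.typicalEvent δ j s t)ᶜ ≤
      ENNReal.ofReal (M.mu δ * Real.exp (-(M.eta δ / 27 * (t - s)))) := by
  have hη : 0 < M.eta δ := by
    have := M.g_pos
    unfold eta
    positivity
  set κ := M.eta δ / 27 with hκ
  have hκ0 : 0 < κ := by positivity
  set r := Real.exp (-κ) with hr
  have hr1 : r < 1 := by
    rw [hr, Real.exp_lt_one_iff]
    linarith
  have hr0 : 0 < r := Real.exp_pos _
  set C := 9 * Real.exp (-(κ * (t - s))) with hC
  have hterm : ∀ p q : ℕ, P (⋃ (_ : (p : ℝ) ≤ s),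
      (M.roundedGoodEvent δ j (s - p) (max 0 (s - p - 1)) (t - s + p + q))ᶜ) ≤
      ENNReal.ofReal C * ENNReal.ofReal r ^ p * ENNReal.ofReal r ^ q := by
    intro p q
    by_cases hp : (p : ℝ) ≤ s
    · have hb := M.prob_compl_roundedGoodEvent_le hα hβ hΔ hδ hδ' hrate j (s := s - p)
        (u := max 0 (s - p - 1)) (ℓ := t - s + p + q) (by linarith) (le_max_left _ _) (by
          have : 0 ≤ δ * ((p : ℝ) + q) := by positivity
          linarith)
      rw [← ENNReal.ofReal_pow hr0.le, ← ENNReal.ofReal_pow hr0.le,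
        ← ENNReal.ofReal_mul (by positivity), ← ENNReal.ofReal_mul (by positivity)]
      simp only [hp, Set.iUnion_true]
      rw [← ofReal_measureReal]
      refine ENNReal.ofReal_le_ofReal (hb.trans (le_of_eq ?_))
      rw [hC, hr, ← Real.exp_nat_mul, ← Real.exp_nat_mul, mul_assoc, mul_assoc, ← Real.exp_add,
        ← Real.exp_add]
      congr 2
      rw [hκ]
      ring
    · simp [hp]
  have hsum : P (M.typicalEvent δ j s t)ᶜ ≤
      ENNReal.ofReal C * (1 - ENNReal.ofReal r)⁻¹ * (1 - ENNReal.ofReal r)⁻¹ := by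
    calc P (M.typicalEvent δ j s t)ᶜ
        ≤ ∑' p : ℕ, ∑' q : ℕ, ENNReal.ofReal C * ENNReal.ofReal r ^ p * ENNReal.ofReal r ^ q :=
          (measure_mono (M.compl_typicalEvent_subset hα hβ hδ (by linarith) j s t)).trans
            ((measure_iUnion_le _).trans (ENNReal.tsum_le_tsum fun p =>
              (measure_iUnion_le _).trans (ENNReal.tsum_le_tsum fun q => hterm p q)))
      _ = _ := by
          simp_rw [ENNReal.tsum_mul_left, ENNReal.tsum_mul_right, ENNReal.tsum_mul_left,
            ENNReal.tsum_geometric]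
  refine hsum.trans ?_
  have h1r : (1 - ENNReal.ofReal r)⁻¹ = ENNReal.ofReal (1 - r)⁻¹ := by
    rw [ENNReal.ofReal_inv_of_pos (by linarith), ENNReal.ofReal_sub _ hr0.le, ENNReal.ofReal_one]
  rw [h1r, ← ENNReal.ofReal_mul (by positivity),
    ← ENNReal.ofReal_mul (mul_nonneg (by positivity) (inv_nonneg.2 (by linarith)))]
  refine ENNReal.ofReal_le_ofReal ?_
  have h2 : M.mu δ = 9 * Real.exp (2 / 27 * M.eta δ) / (1 - r) ^ 2 := by
    rw [mu, hr, hκ]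
    congr 5
    ring
  have h3 : 1 ≤ Real.exp (2 / 27 * M.eta δ) := Real.one_le_exp (by positivity)
  have h4 : M.mu δ * Real.exp (-(κ * (t - s))) =
      C * (1 - r)⁻¹ * (1 - r)⁻¹ * Real.exp (2 / 27 * M.eta δ) := by
    rw [h2, hC]
    field_simp
  rw [h4]
  have h5 : 0 ≤ C * (1 - r)⁻¹ * (1 - r)⁻¹ := by
    have : 0 ≤ (1 - r)⁻¹ := inv_nonneg.2 (by linarith)
    positivity
  exact le_mul_of_one_le_right h5 h3

end PrismModel

theorem mainTheorem8 {Ω : Type*} [MeasurableSpace Ω] (P : Measure Ω) [IsProbabilityMeasure P]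
    (m : ℕ) (α β Δ δ : ℝ) (hα : 1 / 2 < α) (hβ : 0 ≤ β) (hΔ : 0 < Δ)
    (hδ : 0 < δ) (hδ' : δ < 40 / 81)
    (M : PrismModel P m α β Δ)
    (hrate : β < (1 - 81 / 40 * δ) * M.g ^ 2 * α)
    (k : ℕ) (t : ℝ)
    (hk : 160 * α * (1 + Δ) / δ ≤ (k : ℝ))
    (ht : (k : ℝ) / ((1 - 41 / 40 * δ) * M.g * α) ≤ t) :
    (∀ ω ∈ M.typicalEvent δ 0 (t - (k : ℝ) / (2 * α) + Δ) (t - Δ),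
      ∀ (n : ℕ) (b : ℕ → ℕ), M.IsCredibleLeaderSeq ω t n b →
        k ≤ n ∧ (1 - M.g) * (k : ℝ) ≤ (M.honestInLast ω n b k : ℝ)) ∧
    P {ω | ∃ (n : ℕ) (b : ℕ → ℕ), M.IsCredibleLeaderSeq ω t n b ∧
        (n < k ∨ M.g * (k : ℝ) < (M.adversarialInLast ω n b k : ℝ))} ≤
      ENNReal.ofReal
        (M.mu δ * Real.exp (-(M.eta δ / 27 * ((k : ℝ) / (2 * α) - 2 * Δ)))) := by
  have hα0 : 0 < α := by linarith
  have hkey : ∀ ω ∈ M.typicalEvent δ 0 (t - (k : ℝ) / (2 * α) + Δ) (t - Δ),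
      ∀ (n : ℕ) (b : ℕ → ℕ), M.IsCredibleLeaderSeq ω t n b →
        k ≤ n ∧ (M.adversarialInLast ω n b k : ℝ) ≤ M.g * k := by
    rintro ω hω n b ⟨-, hn, c, -, hb⟩
    exact M.leaderSeq_quality hα hΔ hδ hδ' hrate hk ht hω hn
      fun l hl hln => ⟨(hb l hl hln).1, (hb l hl hln).2.1⟩
  refine ⟨fun ω hω n b hb => ?_, ?_⟩
  · obtain ⟨hkn, hA⟩ := hkey ω hω n b hb
    refine ⟨hkn, ?_⟩
    have hadd : (M.honestInLast ω n b k : ℝ) + M.adversarialInLast ω n b k = k := by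
      exact_mod_cast M.honestInLast_add_adversarialInLast ω b hkn
    linarith
  · have hg := M.g_pos
    have hrate' : β ≤ M.g ^ 2 * α := by
      have : 0 < 81 / 40 * δ * (M.g ^ 2 * α) := by positivity
      linarith
    have hlen : t - Δ - (t - (k : ℝ) / (2 * α) + Δ) = k / (2 * α) - 2 * Δ := by ring
    -- The interval is shortened by `Δ` at each end, which costs `2 * δ * Δ < Δ` and turns 80 into
    -- 79.
    have hlong : 79 * (1 + Δ) ≤ δ * (t - Δ - (t - (k : ℝ) / (2 * α) + Δ)) := by
      have h1 : 80 * (1 + Δ) ≤ δ * (k / (2 * α)) := by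
        rw [div_le_iff₀ hδ] at hk
        rw [mul_div_assoc', le_div_iff₀ (by positivity)]
        linarith
      rw [hlen]
      nlinarith
    have hP := M.prob_compl_typicalEvent_le hα0 hβ hΔ hδ hδ' hrate' 0 hlong
    rw [hlen] at hP
    -- Monotonicity of the outer measure suffices, so the bad set need not be measurable.
    refine (measure_mono ?_).trans hP
    rintro ω ⟨n, b, hb, hbad⟩ hω
    obtain ⟨hkn, hA⟩ := hkey ω hω n b hb
    rcases hbad with h | h
    · omega
    · linarith
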